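/- Let $K$ be a field and $A$ a finite-dimensional $K$-algebra; modules are right modules, $D=\mathrm{Hom}_K(-,K)$. The dominant dimension $\mathrm{domdim}(A)\in\mathbb{N}\cup\{\infty\}$ is the supremum of all $n$ such that the first $n$ terms $I_0,\dots,I_{n-1}$ of a minimal injective resolution $0\to A\to I_0\to I_1\to\cdots$ of the regular module are projective. $A$ is called gendo-symmetric if $\mathrm{domdim}(A)\ge 2$ and $D(Ae)\cong eA$ as $(eAe,A)$-bimodules, where $e$ is an idempotent such that $eA$ is the minimal faithful projective-injective $A$-module. For a finitely generated module $M$ let $\mathrm{add}(M)$ be the class of direct summands of finite powers of $M$, and let $\mathrm{size}(M)$ be the number of non-isomorphic indecomposable direct summands of $M$. For $k\ge 1$, $M$ is called $k$-rigid if $\mathrm{Ext}^i_A(X,Y)=0$ for all $X,Y\in\mathrm{add}(M)$ and $1\le i\le k$; put $o_k(A)=\sup\{\mathrm{size}(M) : M \text{ finitely generated and } k\text{-rigid}\}$. The representation dimension of $A$ is the infimum of the global dimensions of $\mathrm{End}_A(M)$, where $M$ runs over the finitely generated modules with all finitely generated projective and all finitely generated injective modules in $\mathrm{add}(M)$. A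 finitely generated module $M$ is maximal $1$-orthogonal if $\mathrm{add}(M)=\{X : \mathrm{Ext}^1_A(M,X)=0\}=\{X : \mathrm{Ext}^1_A(X,M)=0\}$, with $X$ ranging over the finitely generated modules. Let $w$ be the number of simple $A$-modules up to isomorphism. Suppose that $A$ is gendo-symmetric and not selfinjective. Then: (1) If $o_k(A)<\infty$ for some $k\ge 1$, then $\mathrm{domdim}(A)<\infty$, i.e. the Nakayama conjecture holds for $A$. (2) If $A$ has representation dimension at most $3$, or if there is a maximal $1$-orthogonal $A$-module, then $o_1(A)$ and $\mathrm{domdim}(A)$ are finite and $$3\,(o_1(A)+2-w)-1\ \ge\ \mathrm{domdim}(A).$$ -/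

import Mathlib

open CategoryTheory

universe u

/- Modules are left modules over a ring `R`; right modules over an algebra `A` are the modules over
`R = Aᵐᵒᵖ`. Below, `R` stands for such a ring throughout. -/

section Modules

variable (R : Type u) [Ring R]

/-- `X` is (isomorphic to) a direct summand of `M`. -/
def IsDirectSummand {R : Type u} [Ring R] (X M : ModuleCat.{u} R) : Prop :=
  ∃ (i : X →ₗ[R] M) (p : M →ₗ[R] X), p ∘ₗ i = LinearMap.id

/-- `X` belongs to `add M`: it is a direct summand of some finite power `Mⁿ`. -/
def InAdd {R : Type u} [Ring R] (M X : ModuleCat.{u} R) : Prop :=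
  ∃ n : ℕ, IsDirectSummand X (ModuleCat.of R (Fin n → M))

/-- The number of isomorphism classes of modules in a class of `R`-modules. -/
noncomputable def numIsoClasses {R : Type u} [Ring R] (S : Set (ModuleCat.{u} R)) : ℕ∞ :=
  ((fun X => Quotient.mk (isIsomorphicSetoid (ModuleCat.{u} R)) X) '' S).encard

/-- `size M`: the number of pairwise nonisomorphic indecomposable direct summands of `M`. -/
noncomputable def moduleSize {R : Type u} [Ring R] (M : ModuleCat.{u} R) : ℕ∞ :=
  numIsoClasses {X : ModuleCat.{u} R | Indecomposable X ∧ IsDirectSummand X M}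

/-- The number of simple `R`-modules up to isomorphism. -/
noncomputable def numSimpleModules : ℕ∞ :=
  numIsoClasses {X : ModuleCat.{u} R | IsSimpleModule R X}

/-- `Extⁱ(X, Y) = 0` for `1 ≤ i ≤ k`. -/
def ExtVanishes {R : Type u} [Ring R] (k : ℕ) (X Y : ModuleCat.{u} R) : Prop :=
  ∀ i : ℕ, 1 ≤ i → i ≤ k → Subsingleton (Abelian.Ext X Y i)

/-- `M` is `k`-rigid: `add M ⊥ₖ add M`. -/
def IsRigid {R : Type u} [Ring R] (k : ℕ) (M : ModuleCat.{u} R) : Prop :=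
  ∀ X Y : ModuleCat.{u} R, InAdd M X → InAdd M Y → ExtVanishes k X Y

/-- `oₖ`: the supremum of the sizes of the finitely generated `k`-rigid modules. -/
noncomputable def rigidSize (k : ℕ) : ℕ∞ :=
  ⨆ (M : ModuleCat.{u} R) (_ : Module.Finite R M) (_ : IsRigid k M), moduleSize M

/-- A finitely generated module `M` is maximal `n`-orthogonal if, in the category of finitely
generated modules,
`add M = {X | Extⁱ(M, X) = 0 for 1 ≤ i ≤ n} = {X | Extⁱ(X, M) = 0 for 1 ≤ i ≤ n}`. -/
def IsMaximalOrthogonal {R : Type u} [Ring R] (n : ℕ) (M : ModuleCat.{u} R) : Prop :=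
  Module.Finite R M ∧ ∀ X : ModuleCat.{u} R, Module.Finite R X →
    (InAdd M X ↔ ExtVanishes n M X) ∧ (InAdd M X ↔ ExtVanishes n X M)

/-- `M` is a generator-cogenerator of the category of finitely generated modules: it is finitely
generated and all finitely generated projective or injective modules belong to `add M`. -/
def IsGeneratorCogenerator {R : Type u} [Ring R] (M : ModuleCat.{u} R) : Prop :=
  Module.Finite R M ∧ ∀ X : ModuleCat.{u} R, Module.Finite R X →
    (Module.Projective R X ∨ Module.Injective R X) → InAdd M X

/-- The global dimension of `R`: the supremum of the projective dimensions of its modules. -/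
noncomputable def globalDim : WithBot ℕ∞ :=
  ⨆ X : ModuleCat.{u} R, projectiveDimension X

/-- The representation dimension: the infimum of the global dimensions (computed with right
modules) of the endomorphism rings of the generator-cogenerators. -/
noncomputable def representationDim : WithBot ℕ∞ :=
  ⨅ (M : ModuleCat.{u} R) (_ : IsGeneratorCogenerator M), globalDim (Module.End R M)ᵐᵒᵖ

/-- An injective resolution `0 → M → I⁰ → I¹ → ⋯` is minimal if `Ker (Iⁿ → Iⁿ⁺¹)` is an essential
submodule of `Iⁿ` for every `n`. -/
def IsMinimalResolution {R : Type u} [Ring R] {M : ModuleCat.{u} R}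
    (I : InjectiveResolution M) : Prop :=
  ∀ (n : ℕ) (N : Submodule R (I.cocomplex.X n)),
    N ⊓ LinearMap.ker (I.cocomplex.d n (n + 1)).hom = ⊥ → N = ⊥

/-- The dominant dimension of a module: the supremum of all `n` such that the first `n` terms
`I⁰, …, Iⁿ⁻¹` of a minimal injective resolution are projective. (Minimal injective resolutions
exist and are unique up to isomorphism.) -/
noncomputable def dominantDim {R : Type u} [Ring R] (M : ModuleCat.{u} R) : ℕ∞ :=
  ⨆ (n : ℕ) (_ : ∃ I : InjectiveResolution M, IsMinimalResolution I ∧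
    ∀ i < n, Module.Projective R (I.cocomplex.X i)), (n : ℕ∞)

/-- `M` is a minimal faithful module: it is faithful and a direct summand of every (finitely
generated) faithful module. -/
def IsMinimalFaithful {R : Type u} [Ring R] (M : ModuleCat.{u} R) : Prop :=
  FaithfulSMul R M ∧
    ∀ N : ModuleCat.{u} R, Module.Finite R N → FaithfulSMul R N → IsDirectSummand M N

end Modules

section Algebras

/-- The dominant dimension of an algebra: that of its right regular module. -/
noncomputable def algebraDominantDim (A : Type u) [Ring A] : ℕ∞ :=
  dominantDim (ModuleCat.of Aᵐᵒᵖ A)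

/-- The right ideal `eA`, a right `A`-module. -/
abbrev rightIdeal {A : Type u} [Ring A] (e : A) : Submodule Aᵐᵒᵖ A :=
  Submodule.span Aᵐᵒᵖ {e}

/-- The left ideal `Ae`, a left `A`-module. -/
abbrev leftIdeal {A : Type u} [Ring A] (e : A) : Submodule A A :=
  Submodule.span A {e}

/-- `D(Ae) ≅ eA` as `(eAe, A)`-bimodules, where `D = Hom_K(-, K)`. The element `x ∈ eAe` acts on
`f ∈ D(Ae)` from the left by `(x f)(y) = f (y x)`, and `a ∈ A` acts from the right by
`(f a)(y) = f (a y)`. -/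
def DualBimoduleIso (K : Type u) {A : Type u} [Field K] [Ring A] [Algebra K A] (e : A) : Prop :=
  ∃ φ : rightIdeal e ≃ₗ[K] Module.Dual K (leftIdeal e),
    ∀ (b a : A) (z z' : rightIdeal e) (y y' : leftIdeal e),
      (z' : A) = (e * b * e) * z * a → (y' : A) = a * y * (e * b * e) → φ z' y = φ z y'

/-- A finite-dimensional `K`-algebra `A` is gendo-symmetric if its dominant dimension is at least
two and `D(Ae) ≅ eA` as `(eAe, A)`-bimodules, where `e` is an idempotent such that `eA` is the
minimal faithful projective-injective right `A`-module. -/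
def IsGendoSymmetric (K A : Type u) [Field K] [Ring A] [Algebra K A] : Prop :=
  2 ≤ algebraDominantDim A ∧
    ∃ e : A, IsIdempotentElem e ∧
      Module.Injective Aᵐᵒᵖ (rightIdeal e) ∧
      IsMinimalFaithful (ModuleCat.of Aᵐᵒᵖ (rightIdeal e)) ∧
      DualBimoduleIso K e

/-- `A` is selfinjective: its right regular module is injective. -/
def IsSelfinjective (A : Type u) [Ring A] : Prop :=
  Module.Injective Aᵐᵒᵖ A

end Algebras

/-!
The proof bounds the sizes of rigid modules from below by the dominant dimension and, under the
hypotheses of the second part, from above by a number of simple modules.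

*Lower bound.* Let `0 → A → I⁰ → I¹ → ⋯` be a minimal injective resolution with `I⁰, …, Iⁿ⁻¹`
projective, and let `Zⁱ` be its cosyzygies. A projective-injective module with a finitely
generated essential submodule lies in `add (eA)` (`inAdd_of_projective_injective`). The isomorphism
`eA ≅ D(Ae)` is given by a linear form on `A` that is symmetric on `eAe`, and this form provides a
natural isomorphism `Hom(I, A) ≅ D(I)` for `I` in `add (eA)`; in particular `Hom(-, A)` is exact on
`add (eA)` (`DualBimoduleIso.exists_extension`). As `Ext¹(Zˢ, A)` is the homology of `Hom(-, A)` at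
`Iˢ⁻²`, it vanishes for `3 ≤ s ≤ n`. Dimension shifting turns this into `Extᵐ(Zⁱ, Zʲ) = 0` for
`i ≤ j` and for `i ≥ j + m + 2`, so the sum of the `Zⁱ` over the multiples `i` of `k + 2` up to `n`
is `k`-rigid. It contains `A ≅ Z⁰`, hence an indecomposable projective module for every simple
module. Moreover `Extⁱ(Zⁱ, A)` is nonzero because `A` is not injective, while `Extⁱ(Zʲ, A) = 0` for
the other multiples `j` of `k + 2`; so every nonzero multiple contributes a new indecomposable
summand (`CosyzygySequence.le_rigidSize`).

*Upper bound.* If the representation dimension is at most three, or if there is a maximal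
`1`-orthogonal module, there is a finitely generated generator `M` such that `Hom(M, X)` has
projective dimension at most one over `End(M)` for all finitely generated `X`
(`HasShortHomResolutions`). If `X` is `1`-rigid, then `Hom(M, X)` is a partial tilting module, and
such a module has at most as many indecomposable summands as there are simple modules
(`exists_summand_of_card_lt`). Otherwise, since Euler forms `dim Hom(T, -) - dim Ext¹(T, -)` are
determined by their values on simple modules, there would be a linear relation
`∑ aᵢ ⟨Tᵢ, -⟩ = ∑ bⱼ ⟨Tⱼ, -⟩` with positive coefficients and disjoint index sets. Evaluating it on
the quotient of `Tᵢ` by the trace of the `Tⱼ` shows that the `Tⱼ` generate `Tᵢ`; evaluating it on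
the kernel `L` of an approximation `⨁ Tⱼ → Tᵢ` modulo its trace shows `Ext¹(Tᵢ, L) = 0`, so that
the approximation splits. This contradicts the Krull–Schmidt property
(`HasTrivialIdempotents.exists_linearEquiv`).
-/

/-! ### Indecomposable modules -/

section Indecomposable

variable {R : Type u} [Ring R]

/-- A module is indecomposable when it is nonzero and its only idempotent endomorphisms are
`0` and `1`. -/
def HasTrivialIdempotents (R : Type u) [Ring R] (X : Type u) [AddCommGroup X] [Module R X] : Prop :=
  Nontrivial X ∧ ∀ e : X →ₗ[R] X, e ∘ₗ e = e → e = 0 ∨ e = LinearMap.id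

theorem HasTrivialIdempotents.of_indecomposable {X : ModuleCat.{u} R} (h : Indecomposable X) :
    HasTrivialIdempotents R X := by
  refine ⟨?_, fun e he => ?_⟩
  · by_contra hX
    rw [not_nontrivial_iff_subsingleton] at hX
    exact h.1 (ModuleCat.isZero_of_subsingleton X)
  · have hc : IsCompl (LinearMap.range e) (LinearMap.ker e) := by
      have hi : IsIdempotentElem (e : Module.End R X) := he
      exact LinearMap.IsIdempotentElem.isCompl hi
    have iso : X ≅ ModuleCat.of R (LinearMap.range e) ⊞ ModuleCat.of R (LinearMap.ker e) :=
      (Submodule.prodEquivOfIsCompl _ _ hc).symm.toModuleIso ≪≫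
        (ModuleCat.biprodIsoProd (ModuleCat.of R (LinearMap.range e))
          (ModuleCat.of R (LinearMap.ker e))).symm
    rcases h.2 _ _ iso with h0 | h0
    · left
      have hs : Subsingleton (LinearMap.range e) := ModuleCat.subsingleton_of_isZero h0
      ext x
      have := congrArg Subtype.val (Subsingleton.elim (⟨e x, x, rfl⟩ : LinearMap.range e) 0)
      simpa using this
    · right
      have hs : Subsingleton (LinearMap.ker e) := ModuleCat.subsingleton_of_isZero h0
      ext x
      have hx : x - e x ∈ LinearMap.ker e := by
        have := LinearMap.congr_fun he x
        simp only [LinearMap.comp_apply] at this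
        simp [this]
      have := congrArg Subtype.val (Subsingleton.elim (⟨x - e x, hx⟩ : LinearMap.ker e) 0)
      simp only [ZeroMemClass.coe_zero, sub_eq_zero] at this
      simpa using this.symm

theorem HasTrivialIdempotents.indecomposable {X : ModuleCat.{u} R}
    (h : HasTrivialIdempotents R X) : Indecomposable X := by
  refine ⟨fun h0 => ?_, fun Y Z f => ?_⟩
  · have := ModuleCat.subsingleton_of_isZero h0
    exact not_subsingleton_iff_nontrivial.2 h.1 this
  · have hid : (f.hom ≫ Limits.biprod.fst ≫ Limits.biprod.inl ≫ f.inv) ≫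
        (f.hom ≫ Limits.biprod.fst ≫ Limits.biprod.inl ≫ f.inv) =
        f.hom ≫ Limits.biprod.fst ≫ Limits.biprod.inl ≫ f.inv := by
      simp
    have key := h.2 (f.hom ≫ Limits.biprod.fst ≫ Limits.biprod.inl ≫ f.inv).hom (by
      rw [← ModuleCat.hom_comp, hid])
    rcases key with h0 | h1
    · left
      have h0' : f.hom ≫ Limits.biprod.fst ≫ Limits.biprod.inl ≫ f.inv = 0 :=
        ModuleCat.hom_ext h0
      rw [Limits.IsZero.iff_id_eq_zero]
      have := congrArg (fun g => Limits.biprod.inl ≫ f.inv ≫ g ≫ f.hom ≫ Limits.biprod.fst) h0'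
      simpa using this
    · right
      have h1' : f.hom ≫ Limits.biprod.fst ≫ Limits.biprod.inl ≫ f.inv = 𝟙 X :=
        ModuleCat.hom_ext h1
      rw [Limits.IsZero.iff_id_eq_zero]
      have := congrArg (fun g => Limits.biprod.inr ≫ f.inv ≫ g ≫ f.hom ≫ Limits.biprod.snd) h1'
      simpa using this.symm

variable {X : Type u} [AddCommGroup X] [Module R X]

/-- Fitting's lemma: the endomorphism ring of an indecomposable module of finite length is
local. -/
theorem HasTrivialIdempotents.isUnit_or_isUnit_one_sub [IsArtinian R X] [IsNoetherian R X]
    (h : HasTrivialIdempotents R X) (f : Module.End R X) : IsUnit f ∨ IsUnit (1 - f) := by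
  obtain ⟨n, hn⟩ := Filter.eventually_atTop.1 f.eventually_isCompl_ker_pow_range_pow
  have hc := hn (n + 1) (by omega)
  have hp := h.2 (Submodule.projection _ _ hc) (Submodule.isIdempotentElem_projection hc)
  rcases hp with h0 | h1
  · left
    have hb : LinearMap.ker (f ^ (n + 1)) = ⊥ := by
      rw [← Submodule.range_projection hc, h0, LinearMap.range_zero]
    have hinj : Function.Injective f := by
      rw [← LinearMap.ker_eq_bot, eq_bot_iff, ← hb, pow_succ]
      intro x hx
      simp only [LinearMap.mem_ker] at hx ⊢
      simp [hx]
    rw [Module.End.isUnit_iff]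
    exact IsArtinian.bijective_of_injective_endomorphism f hinj
  · right
    have hb : LinearMap.ker (f ^ (n + 1)) = ⊤ := by
      rw [← Submodule.range_projection hc, h1, LinearMap.range_id]
    exact IsNilpotent.isUnit_one_sub ⟨n + 1, LinearMap.ker_eq_top.1 hb⟩

theorem HasTrivialIdempotents.exists_isUnit_of_isUnit_sum [IsArtinian R X] [IsNoetherian R X]
    (h : HasTrivialIdempotents R X) {ι : Type*} (s : Finset ι) (f : ι → Module.End R X)
    (hs : IsUnit (∑ i ∈ s, f i)) : ∃ i ∈ s, IsUnit (f i) := by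
  classical
  induction s using Finset.induction_on with
  | empty =>
    have := h.1
    simp at hs
  | insert a s ha ih =>
    rw [Finset.sum_insert ha] at hs
    obtain ⟨v, hv⟩ := hs
    have h1 : 1 - (↑v⁻¹ * f a : Module.End R X) = ↑v⁻¹ * ∑ i ∈ s, f i := by
      have : (↑v⁻¹ : Module.End R X) * (f a + ∑ i ∈ s, f i) = 1 := by rw [← hv]; simp
      rw [mul_add] at this
      rw [← this]; abel
    rcases h.isUnit_or_isUnit_one_sub (↑v⁻¹ * f a) with hu | hu
    · exact ⟨a, by simp, by simpa using hu⟩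
    · rw [h1] at hu
      obtain ⟨i, hi, hi'⟩ := ih (by simpa using hu)
      exact ⟨i, by simp [hi], hi'⟩

/-- An indecomposable module of finite length that is a direct summand of a finite direct sum of
indecomposable modules is isomorphic to one of them. -/
theorem HasTrivialIdempotents.exists_linearEquiv [IsArtinian R X] [IsNoetherian R X]
    (h : HasTrivialIdempotents R X) {ι : Type*} [Fintype ι] {Y : ι → Type u}
    [∀ j, AddCommGroup (Y j)] [∀ j, Module R (Y j)] (hY : ∀ j, HasTrivialIdempotents R (Y j))
    (i : ∀ j, X →ₗ[R] Y j) (p : ∀ j, Y j →ₗ[R] X) (hip : ∑ j, p j ∘ₗ i j = LinearMap.id) :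
    ∃ j, Nonempty (X ≃ₗ[R] Y j) := by
  have := h.1
  obtain ⟨j, -, hj⟩ := h.exists_isUnit_of_isUnit_sum Finset.univ (fun j => p j ∘ₗ i j) (by
    rw [hip]; exact isUnit_one)
  obtain ⟨v, hv⟩ := hj
  have hl : ∀ x, (↑v⁻¹ : Module.End R X) (p j (i j x)) = x := fun x => by
    have : (↑v⁻¹ * ↑v : Module.End R X) x = x := by simp
    rw [hv] at this
    exact this
  refine ⟨j, ?_⟩
  have hr := (hY j).2 (i j ∘ₗ (↑v⁻¹ : Module.End R X) ∘ₗ p j) (by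
    ext y
    simp [hl])
  rcases hr with h0 | h1
  · exfalso
    obtain ⟨x, hx⟩ := exists_ne (0 : X)
    have := LinearMap.congr_fun h0 (i j x)
    simp only [LinearMap.comp_apply, hl, LinearMap.zero_apply] at this
    apply hx
    rw [← hl x, this]
    simp
  · exact ⟨LinearEquiv.ofLinearMap (i j) ((↑v⁻¹ : Module.End R X) ∘ₗ p j) h1 (by ext x; simp [hl])⟩

/-- Every module of finite length is a finite direct sum of indecomposable modules. -/
theorem exists_indecomposable_decomposition (X : ModuleCat.{u} R) [IsArtinian R X]
    [IsNoetherian R X] :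
    ∃ (n : ℕ) (Y : Fin n → ModuleCat.{u} R) (i : ∀ j, X →ₗ[R] Y j) (p : ∀ j, Y j →ₗ[R] X),
      (∀ j, HasTrivialIdempotents R (Y j)) ∧ (∀ j, i j ∘ₗ p j = LinearMap.id) ∧
        ∑ j, p j ∘ₗ i j = LinearMap.id := by
  obtain ⟨l, hl⟩ : ∃ l : ℕ, Module.length R X = l :=
    ⟨_, (ENat.natCast_toNat (Module.length_ne_top (R := R) (M := X))).symm⟩
  induction l using Nat.strong_induction_on generalizing X with
  | _ l ih =>
    by_cases hX : Subsingleton X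
    · exact ⟨0, Fin.elim0, fun j => j.elim0, fun j => j.elim0, fun j => j.elim0,
        fun j => j.elim0, by ext x; exact Subsingleton.elim _ _⟩
    have hX' : Nontrivial X := not_subsingleton_iff_nontrivial.1 hX
    by_cases hi : HasTrivialIdempotents R X
    · exact ⟨1, fun _ => X, fun _ => LinearMap.id, fun _ => LinearMap.id, fun _ => hi,
        fun _ => rfl, by simp⟩
    have : ∃ e : X →ₗ[R] X, e ∘ₗ e = e ∧ e ≠ 0 ∧ e ≠ LinearMap.id := by
      by_contra hcon
      push Not at hcon
      exact hi ⟨hX', fun e he => or_iff_not_imp_left.2 (hcon e he)⟩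
    obtain ⟨e, he, he0, he1⟩ := this
    have hee : ∀ x, e (e x) = e x := fun x => LinearMap.congr_fun he x
    -- both the kernel and the image of `e` are shorter than `X`
    have hlt : ∀ N : Submodule R X, N ≠ ⊤ → ∃ m < l, Module.length R N = m := by
      intro N hN
      have h1 := Submodule.length_lt hN
      rw [hl] at h1
      obtain ⟨m, hm⟩ := ENat.ne_top_iff_exists.1 h1.ne_top
      rw [← hm] at h1
      exact ⟨m, by exact_mod_cast h1, hm.symm⟩
    obtain ⟨m₁, hm₁, hl₁⟩ := hlt (LinearMap.range e) (fun ht => he1 (by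
      ext x
      obtain ⟨y, rfl⟩ := LinearMap.range_eq_top.1 ht x
      simp [hee]))
    obtain ⟨m₂, hm₂, hl₂⟩ := hlt (LinearMap.ker e) (fun ht => he0 (LinearMap.ker_eq_top.1 ht))
    obtain ⟨n₁, Y₁, i₁, p₁, hY₁, hip₁, hs₁⟩ := ih m₁ hm₁ (ModuleCat.of R (LinearMap.range e)) hl₁
    obtain ⟨n₂, Y₂, i₂, p₂, hY₂, hip₂, hs₂⟩ := ih m₂ hm₂ (ModuleCat.of R (LinearMap.ker e)) hl₂
    let q₁ : X →ₗ[R] LinearMap.range e := e.rangeRestrict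
    let q₂ : X →ₗ[R] LinearMap.ker e := (LinearMap.id - e).codRestrict _ (by intro x; simp [hee])
    have hq₁ : ∀ x, q₁ (x : LinearMap.range e) = x := by
      rintro ⟨_, x, rfl⟩
      apply Subtype.ext
      simp [q₁, hee]
    have hq₂ : ∀ x, q₂ (x : LinearMap.ker e) = x := by
      rintro ⟨x, hx⟩
      apply Subtype.ext
      simp only [LinearMap.mem_ker] at hx
      simp [q₂, hx]
    let Y : Fin n₁ ⊕ Fin n₂ → ModuleCat.{u} R := Sum.elim Y₁ Y₂
    let i' : ∀ j : Fin n₁ ⊕ Fin n₂, X →ₗ[R] Y j := fun j => match j with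
      | Sum.inl j => i₁ j ∘ₗ q₁
      | Sum.inr j => i₂ j ∘ₗ q₂
    let p' : ∀ j : Fin n₁ ⊕ Fin n₂, Y j →ₗ[R] X := fun j => match j with
      | Sum.inl j => (LinearMap.range e).subtype ∘ₗ p₁ j
      | Sum.inr j => (LinearMap.ker e).subtype ∘ₗ p₂ j
    have hY : ∀ k, HasTrivialIdempotents R (Y k) := by
      rintro (k | k)
      · exact hY₁ k
      · exact hY₂ k
    have hip : ∀ k, i' k ∘ₗ p' k = LinearMap.id := by
      rintro (k | k)
      · refine LinearMap.ext fun y => ?_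
        change i₁ k (q₁ (p₁ k y : LinearMap.range e)) = y
        rw [hq₁]
        exact LinearMap.congr_fun (hip₁ k) y
      · refine LinearMap.ext fun y => ?_
        change i₂ k (q₂ (p₂ k y : LinearMap.ker e)) = y
        rw [hq₂]
        exact LinearMap.congr_fun (hip₂ k) y
    refine ⟨n₁ + n₂, fun j => Y (finSumFinEquiv.symm j),
      fun j => i' (finSumFinEquiv.symm j), fun j => p' (finSumFinEquiv.symm j),
      fun j => hY _, fun j => hip _, ?_⟩
    · rw [Equiv.sum_comp finSumFinEquiv.symm (fun k => p' k ∘ₗ i' k), Fintype.sum_sum_type]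
      ext x
      have h1 := congrArg Subtype.val (LinearMap.congr_fun hs₁ (q₁ x))
      have h2 := congrArg Subtype.val (LinearMap.congr_fun hs₂ (q₂ x))
      simp only [LinearMap.sum_apply, LinearMap.comp_apply, LinearMap.id_apply,
        AddSubmonoidClass.coe_finsetSum] at h1 h2
      simp only [LinearMap.add_apply, LinearMap.sum_apply, LinearMap.id_apply]
      change ∑ k, ((p₁ k (i₁ k (q₁ x)) : LinearMap.range e) : X) +
        ∑ k, ((p₂ k (i₂ k (q₂ x)) : LinearMap.ker e) : X) = x
      rw [h1, h2]
      simp [q₁, q₂]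

end Indecomposable

/-! ### Simple modules and indecomposable projective modules -/

section Simple

variable {R : Type u} [Ring R]

/-- An indecomposable projective module of finite length has at most one simple quotient up to
isomorphism. -/
theorem HasTrivialIdempotents.simple_quotient_unique {P S T : Type u}
    [AddCommGroup P] [Module R P] [AddCommGroup S] [Module R S] [AddCommGroup T] [Module R T]
    [IsArtinian R P] [IsNoetherian R P] [Module.Projective R P] (h : HasTrivialIdempotents R P)
    [IsSimpleModule R S] [IsSimpleModule R T] {f : P →ₗ[R] S} {g : P →ₗ[R] T}
    (hf : f ≠ 0) (hg : g ≠ 0) : Nonempty (S ≃ₗ[R] T) := by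
  have hfs := LinearMap.surjective_of_ne_zero hf
  have hgs := LinearMap.surjective_of_ne_zero hg
  by_cases hle : LinearMap.ker f ≤ LinearMap.ker g
  · have heq : LinearMap.ker f = LinearMap.ker g := by
      have hc : IsCoatom (LinearMap.ker f) := LinearMap.isCoatom_ker_of_surjective hfs
      rcases hc.le_iff.1 hle with h0 | h0
      · exact absurd (LinearMap.ker_eq_top.1 h0) hg
      · exact h0.symm
    exact ⟨(LinearMap.quotKerEquivOfSurjective f hfs).symm ≪≫ₗ
      Submodule.quotEquivOfEq _ _ heq ≪≫ₗ LinearMap.quotKerEquivOfSurjective g hgs⟩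
  · exfalso
    -- lift `g` through its restriction to `ker f`: the lift contradicts locality of `End P`
    have hne : g ∘ₗ (LinearMap.ker f).subtype ≠ 0 := by
      intro h0
      apply hle
      intro x hx
      exact LinearMap.congr_fun h0 ⟨x, hx⟩
    obtain ⟨s, hs⟩ := Module.projective_lifting_property (g ∘ₗ (LinearMap.ker f).subtype) g
      (LinearMap.surjective_of_ne_zero hne)
    have hs' : ∀ x, g (s x : P) = g x := fun x => LinearMap.congr_fun hs x
    rcases h.isUnit_or_isUnit_one_sub ((LinearMap.ker f).subtype ∘ₗ s) with hu | hu
    · rw [Module.End.isUnit_iff] at hu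
      apply hf
      ext x
      obtain ⟨y, rfl⟩ := hu.2 x
      exact (s y).2
    · rw [Module.End.isUnit_iff] at hu
      apply hg
      ext x
      obtain ⟨y, rfl⟩ := hu.2 x
      simp [hs']

/-- If the regular module is decomposed as a direct sum, every simple module is a quotient of one
of the summands. -/
theorem exists_ne_zero_of_regular_decomposition {ι : Type*} [Fintype ι] {Y : ι → ModuleCat.{u} R}
    (i : ∀ j, R →ₗ[R] Y j) (p : ∀ j, Y j →ₗ[R] R) (hip : ∑ j, p j ∘ₗ i j = LinearMap.id)
    (S : Type u) [AddCommGroup S] [Module R S] [Nontrivial S] :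
    ∃ j, ∃ f : Y j →ₗ[R] S, f ≠ 0 := by
  by_contra hcon
  push Not at hcon
  obtain ⟨s, hs⟩ := exists_ne (0 : S)
  apply hs
  have h1 := LinearMap.congr_fun hip (1 : R)
  simp only [LinearMap.sum_apply, LinearMap.comp_apply, LinearMap.id_apply] at h1
  have : (LinearMap.toSpanSingleton R S s) (∑ j, p j (i j 1)) = s := by rw [h1]; simp
  rw [← this, map_sum]
  refine Finset.sum_eq_zero fun j _ => ?_
  exact LinearMap.congr_fun (hcon j (LinearMap.toSpanSingleton R S s ∘ₗ p j)) (i j 1)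

variable (R) in
/-- There are indecomposable direct summands `Y j` of the regular module, finitely many, and
simple modules `S` are classified by those `j` with `Hom(Y j, S) ≠ 0`. -/
theorem exists_projective_family [IsArtinian R R] [IsNoetherian R R] :
    ∃ (n : ℕ) (Y : Fin n → ModuleCat.{u} R), (∀ j, HasTrivialIdempotents R (Y j)) ∧
      (∀ j, IsDirectSummand (Y j) (ModuleCat.of R R)) ∧
      (∀ S : ModuleCat.{u} R, IsSimpleModule R S → ∃ j, ∃ f : Y j →ₗ[R] S, f ≠ 0) ∧
      ∀ (S T : ModuleCat.{u} R), IsSimpleModule R S → IsSimpleModule R T →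
        ∀ j, ∀ (f : Y j →ₗ[R] S) (g : Y j →ₗ[R] T), f ≠ 0 → g ≠ 0 → Nonempty (S ≃ₗ[R] T) := by
  have : IsArtinian R (ModuleCat.of R R) := ‹_›
  have : IsNoetherian R (ModuleCat.of R R) := ‹_›
  obtain ⟨n, Y, i, p, hY, hip, hs⟩ := exists_indecomposable_decomposition (ModuleCat.of R R)
  refine ⟨n, Y, hY, fun j => ⟨p j, i j, hip j⟩, fun S hS => ?_, fun S T hS hT j f g hf hg => ?_⟩
  · have := IsSimpleModule.nontrivial R S
    exact exists_ne_zero_of_regular_decomposition i p hs S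
  · have hinj : Function.Injective (p j) :=
      Function.LeftInverse.injective (g := i j) (fun x => LinearMap.congr_fun (hip j) x)
    have := isArtinian_of_injective (p j) hinj
    have := isNoetherian_of_injective (p j) hinj
    have : Module.Projective R (ModuleCat.of R R) := inferInstanceAs (Module.Projective R R)
    have : Module.Projective R (Y j) :=
      Module.Projective.of_split (p j) (i j) (hip j)
    exact (hY j).simple_quotient_unique hf hg

variable (R) in
theorem exists_finite_simple_family [IsArtinian R R] [IsNoetherian R R] :
    ∃ (ι : Type) (_ : Fintype ι) (S : ι → ModuleCat.{u} R), (∀ a, IsSimpleModule R (S a)) ∧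
      ∀ T : ModuleCat.{u} R, IsSimpleModule R T → ∃ a, Nonempty (T ≃ₗ[R] S a) := by
  classical
  obtain ⟨n, Y, -, -, h1, h2⟩ := exists_projective_family R
  refine ⟨{j : Fin n // ∃ S : ModuleCat.{u} R, IsSimpleModule R S ∧ ∃ f : Y j →ₗ[R] S, f ≠ 0},
    inferInstance, fun j => j.2.choose, fun j => j.2.choose_spec.1, fun T hT => ?_⟩
  obtain ⟨j, f, hf⟩ := h1 T hT
  have hj : ∃ S : ModuleCat.{u} R, IsSimpleModule R S ∧ ∃ f : Y j →ₗ[R] S, f ≠ 0 :=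
    ⟨T, hT, f, hf⟩
  refine ⟨⟨j, hj⟩, ?_⟩
  obtain ⟨g, hg⟩ := hj.choose_spec.2
  exact h2 T _ hT hj.choose_spec.1 j f g hf hg

end Simple

/-! ### Partial tilting modules of projective dimension at most one -/

section Tilting

variable {K Γ : Type u} [Field K] [Ring Γ] [Algebra K Γ]

/-- For a projective presentation `π : P → T`, the vanishing of `Ext¹(T, Y)`: every linear map
`Ker π → Y` extends to `P`. -/
def ExtendsAlong {P T : Type u} [AddCommGroup P] [Module Γ P] [AddCommGroup T] [Module Γ T]
    (π : P →ₗ[Γ] T) (Y : Type u) [AddCommGroup Y] [Module Γ Y] : Prop :=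
  ∀ f : LinearMap.ker π →ₗ[Γ] Y, ∃ g : P →ₗ[Γ] Y, ∀ x : LinearMap.ker π, g x = f x

section Extends

variable {P T Y Z : Type u} [AddCommGroup P] [Module Γ P] [AddCommGroup T] [Module Γ T]
  [AddCommGroup Y] [Module Γ Y] [AddCommGroup Z] [Module Γ Z] {π : P →ₗ[Γ] T}

theorem ExtendsAlong.of_surjective [Module.Projective Γ (LinearMap.ker π)]
    (h : ExtendsAlong π Y) (q : Y →ₗ[Γ] Z) (hq : Function.Surjective q) : ExtendsAlong π Z := by
  intro f
  obtain ⟨f', hf'⟩ := Module.projective_lifting_property q f hq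
  obtain ⟨g, hg⟩ := h f'
  exact ⟨q ∘ₗ g, fun x => by rw [LinearMap.comp_apply, hg, ← hf']; rfl⟩

theorem ExtendsAlong.of_submodule [Module.Projective Γ P] {N : Submodule Γ Y}
    (h₁ : ExtendsAlong π N) (h₂ : ExtendsAlong π (Y ⧸ N)) : ExtendsAlong π Y := by
  intro f
  obtain ⟨g, hg⟩ := h₂ (N.mkQ ∘ₗ f)
  obtain ⟨s, hs⟩ := Module.projective_lifting_property N.mkQ g N.mkQ_surjective
  have hmem : ∀ x : LinearMap.ker π, (f - s ∘ₗ (LinearMap.ker π).subtype) x ∈ N := by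
    intro x
    rw [← Submodule.Quotient.mk_eq_zero, ← Submodule.mkQ_apply]
    have h1 : N.mkQ (s x) = g x := LinearMap.congr_fun hs x
    rw [LinearMap.sub_apply, map_sub, LinearMap.comp_apply, Submodule.subtype_apply, h1, hg]
    exact sub_self _
  obtain ⟨k, hk⟩ := h₁ ((f - s ∘ₗ (LinearMap.ker π).subtype).codRestrict N hmem)
  refine ⟨s + N.subtype ∘ₗ k, fun x => ?_⟩
  simp [hk]

theorem ExtendsAlong.pi {α : Type*} {F : α → Type u} [∀ a, AddCommGroup (F a)]
    [∀ a, Module Γ (F a)] (h : ∀ a, ExtendsAlong π (F a)) {Y : Type u} [AddCommGroup Y]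
    [Module Γ Y] (e : Y ≃ₗ[Γ] ((a : α) → F a)) : ExtendsAlong π Y := by
  intro f
  choose g hg using fun a => h a (LinearMap.proj a ∘ₗ e.toLinearMap ∘ₗ f)
  refine ⟨e.symm.toLinearMap ∘ₗ LinearMap.pi g, fun x => ?_⟩
  have : LinearMap.pi g x = e (f x) := by
    ext a
    simp [hg]
  simp [this]

theorem exists_factor_of_ker_le (hπ : Function.Surjective π) (f : P →ₗ[Γ] Y)
    (hf : ∀ x : LinearMap.ker π, f x = 0) : ∃ s : T →ₗ[Γ] Y, s ∘ₗ π = f := by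
  refine ⟨(LinearMap.ker π).liftQ f (fun x hx => hf ⟨x, hx⟩) ∘ₗ
    (LinearMap.quotKerEquivOfSurjective π hπ).symm.toLinearMap, ?_⟩
  ext x
  have : (LinearMap.quotKerEquivOfSurjective π hπ).symm (π x) = Submodule.Quotient.mk x := by
    rw [LinearEquiv.symm_apply_eq]
    simp
  rw [LinearMap.comp_apply, LinearMap.comp_apply, LinearEquiv.coe_coe, this]
  exact Submodule.liftQ_apply _ _ _

/-- If `Ext¹(T, Ker q) = 0`, then maps from `T` lift through the surjection `q`. -/
theorem ExtendsAlong.exists_lift [Module.Projective Γ P] (hπ : Function.Surjective π)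
    (q : Y →ₗ[Γ] Z) (hq : Function.Surjective q) (h : ExtendsAlong π (LinearMap.ker q))
    (t : T →ₗ[Γ] Z) : ∃ s : T →ₗ[Γ] Y, q ∘ₗ s = t := by
  obtain ⟨s, hs⟩ := Module.projective_lifting_property q (t ∘ₗ π) hq
  have hs' : ∀ x, q (s x) = t (π x) := fun x => LinearMap.congr_fun hs x
  obtain ⟨g, hg⟩ := h ((s ∘ₗ (LinearMap.ker π).subtype).codRestrict _ (by
    intro x
    simp [hs']))
  obtain ⟨r, hr⟩ := exists_factor_of_ker_le hπ (s - (LinearMap.ker q).subtype ∘ₗ g) (by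
    intro x
    rw [LinearMap.sub_apply, LinearMap.comp_apply, hg]
    exact sub_self _)
  refine ⟨r, ?_⟩
  ext y
  obtain ⟨x, rfl⟩ := hπ y
  have h1 : r (π x) = s x - (g x : Y) := LinearMap.congr_fun hr x
  simp [h1, hs']

end Extends

section Dimension

variable {X Y : Type u} [AddCommGroup X] [Module Γ X] [Module K X] [IsScalarTower K Γ X]
  [AddCommGroup Y] [Module Γ Y] [Module K Y] [IsScalarTower K Γ Y]

variable (K) in
theorem finite_submodule_of_tower [Module.Finite K X] (N : Submodule Γ X) : Module.Finite K N :=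
  Module.Finite.of_injective (N.subtype.restrictScalars K) N.subtype_injective

variable (K) in
theorem finite_quotient_of_tower [Module.Finite K X] (N : Submodule Γ X) :
    Module.Finite K (X ⧸ N) :=
  Module.Finite.of_surjective (N.mkQ.restrictScalars K) N.mkQ_surjective

variable (K) in
theorem finite_hom_of_tower [Module.Finite K X] [Module.Finite K Y] :
    Module.Finite K (X →ₗ[Γ] Y) :=
  Module.Finite.of_injective
    ({ toFun := fun f => f.restrictScalars K
       map_add' := fun _ _ => rfl
       map_smul' := fun _ _ => rfl } : (X →ₗ[Γ] Y) →ₗ[K] (X →ₗ[K] Y))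
    (fun _ _ h => LinearMap.ext fun x => LinearMap.congr_fun h x)

/-- Postcomposition, linear over the base field. -/
def postcompLinear (K : Type u) {Γ : Type u} [Field K] [Ring Γ] [Algebra K Γ]
    (X : Type u) {Y Z : Type u} [AddCommGroup X] [Module Γ X] [Module K X] [IsScalarTower K Γ X]
    [AddCommGroup Y] [Module Γ Y] [Module K Y] [IsScalarTower K Γ Y]
    [AddCommGroup Z] [Module Γ Z] [Module K Z] [IsScalarTower K Γ Z]
    (q : Y →ₗ[Γ] Z) : (X →ₗ[Γ] Y) →ₗ[K] (X →ₗ[Γ] Z) where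
  toFun f := q ∘ₗ f
  map_add' _ _ := by ext; simp
  map_smul' c f := by
    ext x
    exact (q.restrictScalars K).map_smul c (f x)

/-- Precomposition, linear over the base field. -/
def precompLinear (K : Type u) {Γ : Type u} [Field K] [Ring Γ] [Algebra K Γ]
    {X Y : Type u} (Z : Type u) [AddCommGroup X] [Module Γ X] [AddCommGroup Y] [Module Γ Y]
    [AddCommGroup Z] [Module Γ Z] [Module K Z] [IsScalarTower K Γ Z]
    (q : X →ₗ[Γ] Y) : (Y →ₗ[Γ] Z) →ₗ[K] (X →ₗ[Γ] Z) where
  toFun f := f ∘ₗ q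
  map_add' _ _ := rfl
  map_smul' _ _ := rfl

variable (K) in
/-- `Hom(Q, -)` is exact for projective `Q`, so its dimension is additive. -/
theorem finrank_hom_projective [Module.Projective Γ X] [Module.Finite K X] [Module.Finite K Y]
    (N : Submodule Γ Y) : Module.finrank K (X →ₗ[Γ] Y) =
      Module.finrank K (X →ₗ[Γ] N) + Module.finrank K (X →ₗ[Γ] (Y ⧸ N)) := by
  have := finite_hom_of_tower K (Γ := Γ) (X := X) (Y := Y)
  have hs : LinearMap.range (postcompLinear K X N.mkQ) = ⊤ := by
    rw [LinearMap.range_eq_top]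
    intro f
    exact Module.projective_lifting_property N.mkQ f N.mkQ_surjective
  have hk : LinearMap.ker (postcompLinear K X N.mkQ) =
      LinearMap.range (postcompLinear K X N.subtype) := by
    ext f
    constructor
    · intro hf
      refine ⟨f.codRestrict N fun x => ?_, ?_⟩
      · have := LinearMap.congr_fun (LinearMap.mem_ker.1 hf) x
        exact (Submodule.Quotient.mk_eq_zero N).1 this
      · ext; rfl
    · rintro ⟨g, rfl⟩
      rw [LinearMap.mem_ker]
      ext x
      exact (Submodule.Quotient.mk_eq_zero N).2 (g x).2
  have hi : Function.Injective (postcompLinear K X N.subtype) := by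
    intro f g hfg
    ext x
    exact LinearMap.congr_fun hfg x
  have := LinearMap.finrank_range_add_finrank_ker (postcompLinear K X N.mkQ)
  rw [hs, hk, finrank_top, LinearMap.finrank_range_of_inj hi] at this
  omega

variable {P T : Type u} [AddCommGroup P] [Module Γ P] [Module K P] [IsScalarTower K Γ P]
  [AddCommGroup T] [Module Γ T]

/-- The Euler form `dim Hom(T, Y) - dim Ext¹(T, Y)` of a module `T` with projective presentation
`0 → Ker π → P → T → 0`, computed as `dim Hom(P, Y) - dim Hom(Ker π, Y)`. -/
noncomputable def eulerForm (K : Type u) {Γ : Type u} [Field K] [Ring Γ] [Algebra K Γ]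
    {P T : Type u} [AddCommGroup P] [Module Γ P] [AddCommGroup T] [Module Γ T]
    (π : P →ₗ[Γ] T) (Y : Type u) [AddCommGroup Y] [Module Γ Y] [Module K Y]
    [IsScalarTower K Γ Y] : ℤ :=
  (Module.finrank K (P →ₗ[Γ] Y) : ℤ) - Module.finrank K (LinearMap.ker π →ₗ[Γ] Y)

theorem finrank_hom_eq_add_range [Module.Finite K P] [Module.Finite K Y] {π : P →ₗ[Γ] T}
    (hπ : Function.Surjective π) : Module.finrank K (P →ₗ[Γ] Y) = Module.finrank K (T →ₗ[Γ] Y) +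
      Module.finrank K (LinearMap.range (precompLinear K Y (LinearMap.ker π).subtype)) := by
  have := finite_hom_of_tower K (Γ := Γ) (X := P) (Y := Y)
  have hk : LinearMap.ker (precompLinear K Y (LinearMap.ker π).subtype) =
      LinearMap.range (precompLinear K Y π) := by
    ext f
    constructor
    · intro hf
      exact exists_factor_of_ker_le hπ f (fun x => LinearMap.congr_fun (LinearMap.mem_ker.1 hf) x)
    · rintro ⟨g, rfl⟩
      rw [LinearMap.mem_ker]
      ext x
      change g (π x) = 0
      rw [x.2, map_zero]
  have hi : Function.Injective (precompLinear K Y π) := by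
    intro f g hfg
    ext y
    obtain ⟨x, rfl⟩ := hπ y
    exact LinearMap.congr_fun hfg x
  have := LinearMap.finrank_range_add_finrank_ker (precompLinear K Y (LinearMap.ker π).subtype)
  rw [hk, LinearMap.finrank_range_of_inj hi] at this
  omega

theorem ExtendsAlong.eulerForm_eq [Module.Finite K P] [Module.Finite K Y] {π : P →ₗ[Γ] T}
    (hπ : Function.Surjective π) (h : ExtendsAlong π Y) :
    eulerForm K π Y = Module.finrank K (T →ₗ[Γ] Y) := by
  have hs : LinearMap.range (precompLinear K Y (LinearMap.ker π).subtype) = ⊤ := by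
    rw [LinearMap.range_eq_top]
    intro f
    obtain ⟨g, hg⟩ := h f
    exact ⟨g, LinearMap.ext hg⟩
  have := finrank_hom_eq_add_range (K := K) (Y := Y) hπ
  rw [hs, finrank_top] at this
  rw [eulerForm, this]
  simp

theorem eulerForm_nonpos [Module.Finite K P] [Module.Finite K Y] {π : P →ₗ[Γ] T}
    (hπ : Function.Surjective π) (h : ∀ f : T →ₗ[Γ] Y, f = 0) : eulerForm K π Y ≤ 0 := by
  have := finite_submodule_of_tower K (LinearMap.ker π)
  have := finite_hom_of_tower K (Γ := Γ) (X := LinearMap.ker π) (Y := Y)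
  have h1 := finrank_hom_eq_add_range (K := K) (Y := Y) hπ
  have : Subsingleton (T →ₗ[Γ] Y) := ⟨fun f g => by rw [h f, h g]⟩
  rw [Module.finrank_zero_of_subsingleton (M := T →ₗ[Γ] Y), zero_add] at h1
  have h2 := Submodule.finrank_le (LinearMap.range (precompLinear K Y (LinearMap.ker π).subtype))
  rw [eulerForm, h1]
  omega

theorem ExtendsAlong.of_eulerForm_eq_zero [Module.Finite K P] [Module.Finite K Y]
    {π : P →ₗ[Γ] T} (hπ : Function.Surjective π) (h : ∀ f : T →ₗ[Γ] Y, f = 0)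
    (h0 : eulerForm K π Y = 0) : ExtendsAlong π Y := by
  have := finite_submodule_of_tower K (LinearMap.ker π)
  have := finite_hom_of_tower K (Γ := Γ) (X := LinearMap.ker π) (Y := Y)
  have h1 := finrank_hom_eq_add_range (K := K) (Y := Y) hπ
  have : Subsingleton (T →ₗ[Γ] Y) := ⟨fun f g => by rw [h f, h g]⟩
  rw [Module.finrank_zero_of_subsingleton (M := T →ₗ[Γ] Y), zero_add] at h1
  rw [eulerForm, h1] at h0
  have hs : LinearMap.range (precompLinear K Y (LinearMap.ker π).subtype) = ⊤ :=
    Submodule.eq_top_of_finrank_eq (by omega)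
  intro f
  obtain ⟨g, hg⟩ := LinearMap.range_eq_top.1 hs f
  exact ⟨g, fun x => LinearMap.congr_fun hg x⟩

theorem eulerForm_add [Module.Finite K P] [Module.Finite K Y] {π : P →ₗ[Γ] T}
    [Module.Projective Γ P] [Module.Projective Γ (LinearMap.ker π)] (N : Submodule Γ Y) :
    eulerForm K π Y = eulerForm K π N + eulerForm K π (Y ⧸ N) := by
  have := finite_submodule_of_tower K (LinearMap.ker π)
  rw [eulerForm, eulerForm, eulerForm, finrank_hom_projective K N,
    finrank_hom_projective (X := LinearMap.ker π) K N]
  push_cast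
  ring

theorem eulerForm_congr {Z : Type u} [AddCommGroup Z] [Module Γ Z] [Module K Z]
    [IsScalarTower K Γ Z] (e : Y ≃ₗ[Γ] Z) (π : P →ₗ[Γ] T) :
    eulerForm K π Y = eulerForm K π Z := by
  have h : ∀ (W : Type u) [AddCommGroup W] [Module Γ W] [Module K W] [IsScalarTower K Γ W],
      Module.finrank K (W →ₗ[Γ] Y) = Module.finrank K (W →ₗ[Γ] Z) := by
    intro W _ _ _ _
    refine LinearEquiv.finrank_eq (LinearEquiv.ofLinearMap (postcompLinear K W e.toLinearMap)
      (postcompLinear K W e.symm.toLinearMap) ?_ ?_)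
    · ext f x; simp [postcompLinear]
    · ext f x; simp [postcompLinear]
  rw [eulerForm, eulerForm, h, h]

end Dimension

section Family

variable {ι : Type} {P T : ι → Type u}
  [∀ i, AddCommGroup (P i)] [∀ i, Module Γ (P i)] [∀ i, Module K (P i)]
  [∀ i, IsScalarTower K Γ (P i)]
  [∀ i, AddCommGroup (T i)] [∀ i, Module Γ (T i)]

/-- An integral combination of Euler forms that vanishes on the simple modules vanishes. -/
theorem sum_eulerForm_eq_zero [Fintype ι] [∀ i, Module.Finite K (P i)]
    [∀ i, Module.Projective Γ (P i)] (π : ∀ i, P i →ₗ[Γ] T i)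
    [∀ i, Module.Projective Γ (LinearMap.ker (π i))] (c : ι → ℤ)
    (h : ∀ (S : Type u) [AddCommGroup S] [Module Γ S] [Module K S] [IsScalarTower K Γ S]
      [Module.Finite K S], IsSimpleModule Γ S → ∑ i, c i * eulerForm K (π i) S = 0)
    (Y : Type u) [AddCommGroup Y] [Module Γ Y] [Module K Y] [IsScalarTower K Γ Y]
    [Module.Finite K Y] : ∑ i, c i * eulerForm K (π i) Y = 0 := by
  obtain ⟨d, hd⟩ : ∃ d : ℕ, Module.finrank K Y = d := ⟨_, rfl⟩
  induction d using Nat.strong_induction_on generalizing Y with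
  | _ d ih =>
    by_cases hY : Subsingleton Y
    · refine Finset.sum_eq_zero fun i _ => ?_
      simp [eulerForm, Module.finrank_zero_of_subsingleton]
    · have : Nontrivial Y := not_subsingleton_iff_nontrivial.1 hY
      have : IsNoetherian Γ Y := by
        have : IsNoetherian K Y := inferInstance
        exact isNoetherian_of_tower K this
      obtain ⟨N, hN, -⟩ := (eq_top_or_exists_le_coatom (⊥ : Submodule Γ Y)).resolve_left bot_ne_top
      have hS : IsSimpleModule Γ (Y ⧸ N) := isSimpleModule_iff_isCoatom.2 hN
      have := finite_submodule_of_tower K N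
      have := finite_quotient_of_tower K N
      have hlt : Module.finrank K N < d := by
        rw [← hd]
        refine Submodule.finrank_lt (s := N.restrictScalars K) ?_
        rw [Ne, Submodule.restrictScalars_eq_top_iff]
        exact hN.1
      have h1 := ih _ hlt N rfl
      have h2 := h (Y ⧸ N) hS
      simp_rw [eulerForm_add N, mul_add, Finset.sum_add_distrib]
      rw [h1, h2, add_zero]

variable [∀ i, Module K (T i)] [∀ i, IsScalarTower K Γ (T i)]

/-- A finite direct sum of members of the family indexed by `J`, with a map to `Y` through which
every map from a member of the family indexed by `J` factors. -/
theorem exists_right_approximation [∀ i, Module.Finite K (T i)] (J : Set ι) [Finite J]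
    (Y : Type u) [AddCommGroup Y] [Module Γ Y] [Module K Y] [IsScalarTower K Γ Y]
    [Module.Finite K Y] :
    ∃ (α : Type) (_ : Fintype α) (c : α → ι) (q : ((a : α) → T (c a)) →ₗ[Γ] Y),
      (∀ a, c a ∈ J) ∧
        ∀ j ∈ J, ∀ h : T j →ₗ[Γ] Y, ∃ g : T j →ₗ[Γ] ((a : α) → T (c a)), q ∘ₗ g = h := by
  classical
  have := Fintype.ofFinite J
  have hfin : ∀ i, Module.Finite K (T i →ₗ[Γ] Y) := fun i => finite_hom_of_tower K
  let b : ∀ i, Module.Basis (Fin (Module.finrank K (T i →ₗ[Γ] Y))) K (T i →ₗ[Γ] Y) :=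
    fun i => Module.finBasis K _
  let α := Σ j : J, Fin (Module.finrank K (T j →ₗ[Γ] Y))
  let q : ((a : α) → T a.1) →ₗ[Γ] Y := ∑ a : α, b a.1 a.2 ∘ₗ LinearMap.proj a
  refine ⟨α, inferInstance, fun a => a.1, q, fun a => a.1.2, fun j hj h => ?_⟩
  let g : T j →ₗ[Γ] ((a : α) → T a.1) := ∑ m, (LinearMap.single Γ (fun a : α => T a.1)
    ⟨⟨j, hj⟩, m⟩) ∘ₗ ((b j).repr h m • LinearMap.id)
  have hq : ∀ (a : α) (x : T a.1), q (Pi.single a x) = b a.1 a.2 x := by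
    intro a x
    simp only [q, LinearMap.sum_apply, LinearMap.comp_apply, LinearMap.proj_apply]
    rw [Finset.sum_eq_single a]
    · simp
    · intro a' _ ha'
      simp [Pi.single_eq_of_ne ha']
    · simp
  refine ⟨g, ?_⟩
  ext x
  conv_rhs => rw [← (b j).sum_repr h]
  simp only [g, LinearMap.comp_apply, LinearMap.sum_apply, map_sum, LinearMap.smul_apply]
  refine Finset.sum_congr rfl fun m _ => ?_
  rw [LinearMap.coe_single, hq ⟨⟨j, hj⟩, m⟩]
  exact ((b j m).restrictScalars K).map_smul _ _

/-- If the Euler forms of a rigid family of modules of projective dimension at most one satisfy a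
linear relation, a member with a positive coefficient is a direct summand of a finite direct sum
of members with negative coefficients. -/
theorem exists_summand_of_sum_eulerForm_eq_zero [Fintype ι] [∀ i, Module.Finite K (P i)]
    [∀ i, Module.Finite K (T i)] [∀ i, Module.Projective Γ (P i)] (π : ∀ i, P i →ₗ[Γ] T i)
    (hπ : ∀ i, Function.Surjective (π i)) [∀ i, Module.Projective Γ (LinearMap.ker (π i))]
    (hrigid : ∀ i j, ExtendsAlong (π i) (T j)) (c : ι → ℤ)
    (hc : ∀ (Y : Type u) [AddCommGroup Y] [Module Γ Y] [Module K Y] [IsScalarTower K Γ Y]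
      [Module.Finite K Y], ∑ i, c i * eulerForm K (π i) Y = 0) {i₀ : ι} (hi₀ : 0 < c i₀) :
    ∃ (α : Type) (_ : Fintype α) (d : α → ι) (f : ∀ a, T i₀ →ₗ[Γ] T (d a))
      (p : ∀ a, T (d a) →ₗ[Γ] T i₀), (∀ a, d a ≠ i₀) ∧ ∑ a, p a ∘ₗ f a = LinearMap.id := by
  classical
  let J : Set ι := {j | c j < 0}
  have hpi : ∀ {α : Type} [Fintype α] (d : α → ι) (i : ι),
      ExtendsAlong (π i) ((a : α) → T (d a)) := fun d i =>
    ExtendsAlong.pi (fun a => hrigid i (d a)) (LinearEquiv.refl _ _)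
  -- Hom(T j, Y / im q) = 0 for an approximation `q` of `Y` with `Ext¹(T j, im q) = 0`
  have hquot : ∀ (Y : Type u) [AddCommGroup Y] [Module Γ Y] (α : Type) [Fintype α] (d : α → ι)
      (q : ((a : α) → T (d a)) →ₗ[Γ] Y), ∀ j,
      (∀ h : T j →ₗ[Γ] Y, ∃ g : T j →ₗ[Γ] ((a : α) → T (d a)), q ∘ₗ g = h) →
      ∀ t : T j →ₗ[Γ] (Y ⧸ LinearMap.range q), t = 0 := by
    intro Y _ _ α _ d q j hq t
    have hext : ExtendsAlong (π j) (LinearMap.ker (LinearMap.range q).mkQ) := by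
      rw [Submodule.ker_mkQ]
      exact (hpi d j).of_surjective q.rangeRestrict q.surjective_rangeRestrict
    obtain ⟨s, rfl⟩ := hext.exists_lift (hπ j) _ (Submodule.mkQ_surjective _) t
    obtain ⟨g, rfl⟩ := hq s
    ext x
    simp
  -- the members with positive coefficients are generated by those with negative coefficients
  have hgen : ∀ i, 0 < c i → ∃ (α : Type) (_ : Fintype α) (d : α → ι)
      (q : ((a : α) → T (d a)) →ₗ[Γ] T i), (∀ a, d a ∈ J) ∧ Function.Surjective q ∧
        ∀ j ∈ J, ∀ h : T j →ₗ[Γ] T i, ∃ g : T j →ₗ[Γ] ((a : α) → T (d a)), q ∘ₗ g = h := by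
    intro i hi
    obtain ⟨α, _, d, q, hd, hq⟩ := exists_right_approximation (K := K) (Γ := Γ) (T := T) J (T i)
    refine ⟨α, inferInstance, d, q, hd, ?_, hq⟩
    have := finite_quotient_of_tower K (LinearMap.range q)
    have hext : ∀ l, ExtendsAlong (π l) (T i ⧸ LinearMap.range q) := fun l =>
      (hrigid l i).of_surjective _ (Submodule.mkQ_surjective _)
    have hfin := finite_hom_of_tower K (Γ := Γ) (X := T i) (Y := T i ⧸ LinearMap.range q)
    have hsum := hc (T i ⧸ LinearMap.range q)
    have hnonneg : ∀ l ∈ Finset.univ,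
        0 ≤ c l * eulerForm K (π l) (T i ⧸ LinearMap.range q) := by
      intro l _
      rw [(hext l).eulerForm_eq (hπ l)]
      rcases lt_or_ge (c l) 0 with hl | hl
      · have : Subsingleton (T l →ₗ[Γ] (T i ⧸ LinearMap.range q)) :=
          ⟨fun f g => by
            rw [hquot _ _ d q l (hq l hl) f, hquot _ _ d q l (hq l hl) g]⟩
        simp [Module.finrank_zero_of_subsingleton]
      · positivity
    have hz := (Finset.sum_eq_zero_iff_of_nonneg hnonneg).1 hsum i (Finset.mem_univ i)
    rw [(hext i).eulerForm_eq (hπ i)] at hz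
    have hz' : Module.finrank K (T i →ₗ[Γ] (T i ⧸ LinearMap.range q)) = 0 := by
      rcases mul_eq_zero.1 hz with h | h
      · omega
      · exact_mod_cast h
    have hsub := Module.finrank_zero_iff.1 hz'
    have hmk : (LinearMap.range q).mkQ = 0 := Subsingleton.elim _ _
    rw [← LinearMap.range_eq_top, ← Submodule.ker_mkQ (LinearMap.range q), hmk, LinearMap.ker_zero]
  obtain ⟨α, _, d, q, hd, hqs, hq⟩ := hgen i₀ hi₀
  have : Module.Finite K (LinearMap.ker q) := finite_submodule_of_tower K _
  obtain ⟨β, _, d', r, hd', hr⟩ :=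
    exists_right_approximation (K := K) (Γ := Γ) (T := T) J (LinearMap.ker q)
  have hfinq := finite_quotient_of_tower K (LinearMap.range r)
  -- `Ext¹(T j, Ker q) = 0` for negative coefficients, since `q` is an approximation
  have hextJ : ∀ j ∈ J, ExtendsAlong (π j) (LinearMap.ker q) := by
    intro j hj f
    obtain ⟨g, hg⟩ := hpi d j ((LinearMap.ker q).subtype ∘ₗ f)
    obtain ⟨s, hs⟩ := exists_factor_of_ker_le (hπ j) (q ∘ₗ g) (by
      intro x
      simp [hg])
    obtain ⟨s', hs'⟩ := hq j hj s
    have hk : ∀ x, (g - s' ∘ₗ π j) x ∈ LinearMap.ker q := by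
      intro x
      have h1 : q (s' (π j x)) = s (π j x) := LinearMap.congr_fun hs' _
      have h2 : s (π j x) = q (g x) := LinearMap.congr_fun hs _
      simp [h1, h2]
    refine ⟨(g - s' ∘ₗ π j).codRestrict _ hk, fun x => ?_⟩
    apply Subtype.ext
    simp [hg]
  have hhomJ : ∀ j ∈ J, ∀ t : T j →ₗ[Γ] (LinearMap.ker q ⧸ LinearMap.range r), t = 0 :=
    fun j hj => hquot _ _ d' r j (hr j hj)
  have heulJ : ∀ j ∈ J, eulerForm K (π j) (LinearMap.ker q ⧸ LinearMap.range r) = 0 := by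
    intro j hj
    have h1 : ExtendsAlong (π j) (LinearMap.ker q ⧸ LinearMap.range r) :=
      (hextJ j hj).of_surjective _ (Submodule.mkQ_surjective _)
    have : Subsingleton (T j →ₗ[Γ] (LinearMap.ker q ⧸ LinearMap.range r)) :=
      ⟨fun f g => by rw [hhomJ j hj f, hhomJ j hj g]⟩
    rw [h1.eulerForm_eq (hπ j), Module.finrank_zero_of_subsingleton]
    rfl
  have hhomI : ∀ i, 0 < c i → ∀ t : T i →ₗ[Γ] (LinearMap.ker q ⧸ LinearMap.range r), t = 0 := by
    intro i hi t
    obtain ⟨α', _, e, s, he, hs, -⟩ := hgen i hi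
    have h0 : t ∘ₗ s = 0 := by
      refine LinearMap.pi_ext fun a x => ?_
      exact LinearMap.congr_fun (hhomJ (e a) (he a)
        ((t ∘ₗ s) ∘ₗ LinearMap.single Γ (fun a => T (e a)) a)) x
    ext x
    obtain ⟨y, rfl⟩ := hs x
    exact LinearMap.congr_fun h0 y
  have hsum := hc (LinearMap.ker q ⧸ LinearMap.range r)
  have hnonpos : ∀ l ∈ Finset.univ,
      c l * eulerForm K (π l) (LinearMap.ker q ⧸ LinearMap.range r) ≤ 0 := by
    intro l _
    rcases lt_trichotomy (c l) 0 with hl | hl | hl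
    · rw [heulJ l hl, mul_zero]
    · rw [hl, zero_mul]
    · exact mul_nonpos_of_nonneg_of_nonpos hl.le (eulerForm_nonpos (hπ l) (hhomI l hl))
  have hz := (Finset.sum_eq_zero_iff_of_nonpos hnonpos).1 hsum i₀ (Finset.mem_univ i₀)
  have hz' := (mul_eq_zero.1 hz).resolve_left hi₀.ne'
  have hext : ExtendsAlong (π i₀) (LinearMap.ker q) :=
    ExtendsAlong.of_submodule (N := LinearMap.range r)
      ((hpi d' i₀).of_surjective r.rangeRestrict r.surjective_rangeRestrict)
      (ExtendsAlong.of_eulerForm_eq_zero (hπ i₀) (hhomI i₀ hi₀) hz')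
  obtain ⟨s, hs⟩ := hext.exists_lift (hπ i₀) q hqs LinearMap.id
  refine ⟨α, inferInstance, d, fun a => LinearMap.proj a ∘ₗ s,
    fun a => q ∘ₗ LinearMap.single Γ (fun a => T (d a)) a, fun a ha => ?_, ?_⟩
  · have h1 : c (d a) < 0 := hd a
    rw [ha] at h1
    omega
  · ext x
    conv_rhs => rw [← hs]
    simp only [LinearMap.sum_apply, LinearMap.comp_apply, ← map_sum]
    congr 1
    exact LinearMap.sum_single_apply _ _

/-- A rigid family of modules of projective dimension at most one with more members than there
are simple modules has a member that is a direct summand of a finite direct sum of other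
members. -/
theorem exists_summand_of_card_lt [Fintype ι] [Module.Finite K Γ] [∀ i, Module.Finite K (P i)]
    [∀ i, Module.Finite K (T i)] [∀ i, Module.Projective Γ (P i)] (π : ∀ i, P i →ₗ[Γ] T i)
    (hπ : ∀ i, Function.Surjective (π i)) [∀ i, Module.Projective Γ (LinearMap.ker (π i))]
    (hrigid : ∀ i j, ExtendsAlong (π i) (T j))
    {κ : Type} [Fintype κ] (S : κ → ModuleCat.{u} Γ)
    (hS : ∀ U : ModuleCat.{u} Γ, IsSimpleModule Γ U → ∃ a, Nonempty (U ≃ₗ[Γ] S a))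
    (hcard : Fintype.card κ < Fintype.card ι) :
    ∃ (i₀ : ι) (α : Type) (_ : Fintype α) (d : α → ι) (f : ∀ a, T i₀ →ₗ[Γ] T (d a))
      (p : ∀ a, T (d a) →ₗ[Γ] T i₀), (∀ a, d a ≠ i₀) ∧ ∑ a, p a ∘ₗ f a = LinearMap.id := by
  let _ : ∀ a, Module K (S a) := fun a => Module.compHom (S a) (algebraMap K Γ)
  have : ∀ a, IsScalarTower K Γ (S a) := fun a => ⟨fun x y z => by
    rw [Algebra.smul_def, mul_smul]; rfl⟩
  let v : ι → (κ → ℤ) := fun i a => eulerForm K (π i) (S a)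
  have hdep : ¬ LinearIndependent ℤ v := fun h => by
    have := h.fintype_card_le_finrank
    rw [Module.finrank_fintype_fun_eq_card] at this
    omega
  rw [Fintype.not_linearIndependent_iff] at hdep
  obtain ⟨c, hc, i₁, hi₁⟩ := hdep
  have hcS : ∀ (U : Type u) [AddCommGroup U] [Module Γ U] [Module K U] [IsScalarTower K Γ U]
      [Module.Finite K U], IsSimpleModule Γ U → ∑ i, c i * eulerForm K (π i) U = 0 := by
    intro U _ _ _ _ _ hU
    obtain ⟨a, ⟨e⟩⟩ := hS (ModuleCat.of Γ U) hU
    have h1 := congrFun hc a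
    simp only [Finset.sum_apply, Pi.smul_apply, smul_eq_mul, Pi.zero_apply, v] at h1
    rw [← h1]
    refine Finset.sum_congr rfl fun i _ => ?_
    rw [eulerForm_congr (K := K) (Y := U) e]
  rcases lt_or_gt_of_ne hi₁ with h | h
  · refine ⟨i₁, exists_summand_of_sum_eulerForm_eq_zero (K := K) π hπ hrigid (fun i => - c i) ?_ (by
      simpa using h)⟩
    intro Y _ _ _ _ _
    have := sum_eulerForm_eq_zero π c hcS Y
    simp [this]
  · exact ⟨i₁, exists_summand_of_sum_eulerForm_eq_zero (K := K) π hπ hrigid c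
      (fun Y => sum_eulerForm_eq_zero π c hcS Y) h⟩

end Family

end Tilting

/-! ### Vanishing of Ext groups -/

section ExtVanishing

open Abelian

variable {C : Type*} [Category.{u} C] [Abelian C] [HasExt.{u} C] {S : ShortComplex C}

theorem exists_extension_of_ext_one (hS : S.ShortExact) {Y : C}
    [Subsingleton (Ext S.X₃ Y 1)] (f : S.X₁ ⟶ Y) : ∃ g : S.X₂ ⟶ Y, S.f ≫ g = f := by
  obtain ⟨x, hx⟩ := Ext.contravariant_sequence_exact₁ hS Y (Ext.mk₀ f) (add_zero 1)
    (Subsingleton.elim _ _)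
  obtain ⟨g, rfl⟩ := Ext.mk₀_bijective _ _ |>.2 x
  refine ⟨g, (Ext.mk₀_bijective _ _).1 ?_⟩
  rw [← hx, Ext.mk₀_comp_mk₀]

theorem ext_one_subsingleton_of_extension (hS : S.ShortExact) {Y : C} [Projective S.X₂]
    (h : ∀ f : S.X₁ ⟶ Y, ∃ g : S.X₂ ⟶ Y, S.f ≫ g = f) : Subsingleton (Ext S.X₃ Y 1) := by
  refine subsingleton_of_forall_eq 0 fun x => ?_
  obtain ⟨y, rfl⟩ := Ext.contravariant_sequence_exact₃ hS Y x
    (Ext.eq_zero_of_projective _) (add_zero 1)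
  obtain ⟨f, rfl⟩ := Ext.mk₀_bijective _ _ |>.2 y
  obtain ⟨g, rfl⟩ := h f
  rw [← Ext.mk₀_comp_mk₀, hS.extClass_comp_assoc]

theorem ext_one_subsingleton_of_lift (hS : S.ShortExact) {X : C} [Subsingleton (Ext X S.X₂ 1)]
    (h : ∀ f : X ⟶ S.X₃, ∃ g : X ⟶ S.X₂, g ≫ S.g = f) : Subsingleton (Ext X S.X₁ 1) := by
  refine subsingleton_of_forall_eq 0 fun x => ?_
  obtain ⟨y, rfl⟩ := Ext.covariant_sequence_exact₁ X hS x (Subsingleton.elim _ _) (zero_add 1)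
  obtain ⟨f, rfl⟩ := Ext.mk₀_bijective _ _ |>.2 y
  obtain ⟨g, rfl⟩ := h f
  rw [← Ext.mk₀_comp_mk₀, Ext.comp_assoc_of_second_deg_zero, hS.comp_extClass, Ext.comp_zero]

/-- Dimension shifting in the first argument, along a projective middle term. -/
theorem ext_subsingleton_succ_iff_left (hS : S.ShortExact) (Y : C) [Projective S.X₂] {m : ℕ}
    (hm : 1 ≤ m) : Subsingleton (Ext S.X₃ Y (m + 1)) ↔ Subsingleton (Ext S.X₁ Y m) := by
  obtain ⟨m, rfl⟩ := Nat.exists_eq_add_of_le' hm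
  constructor
  · intro h
    refine subsingleton_of_forall_eq 0 fun x => ?_
    obtain ⟨y, rfl⟩ := Ext.contravariant_sequence_exact₁ hS Y x (add_comm 1 (m + 1))
      (Subsingleton.elim _ _)
    rw [y.eq_zero_of_projective, Ext.comp_zero]
  · intro h
    refine subsingleton_of_forall_eq 0 fun x => ?_
    obtain ⟨y, rfl⟩ := Ext.contravariant_sequence_exact₃ hS Y x
      (Ext.eq_zero_of_projective _) (add_comm 1 (m + 1))
    rw [Subsingleton.elim y 0, Ext.comp_zero]

/-- Dimension shifting in the second argument, along an injective middle term. -/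
theorem ext_subsingleton_succ_iff_right (hS : S.ShortExact) (X : C) [Injective S.X₂] {m : ℕ}
    (hm : 1 ≤ m) : Subsingleton (Ext X S.X₁ (m + 1)) ↔ Subsingleton (Ext X S.X₃ m) := by
  obtain ⟨m, rfl⟩ := Nat.exists_eq_add_of_le' hm
  constructor
  · intro h
    refine subsingleton_of_forall_eq 0 fun x => ?_
    obtain ⟨y, rfl⟩ := Ext.covariant_sequence_exact₃ X hS x rfl (Subsingleton.elim _ _)
    rw [y.eq_zero_of_injective, Ext.zero_comp]
  · intro h
    refine subsingleton_of_forall_eq 0 fun x => ?_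
    obtain ⟨y, rfl⟩ := Ext.covariant_sequence_exact₁ X hS x (Ext.eq_zero_of_injective _) rfl
    rw [Subsingleton.elim y 0, Ext.zero_comp]

theorem ext_subsingleton_of_sum_left {ι : Type*} [Fintype ι] {X Y : C} {F : ι → C}
    (i : ∀ j, X ⟶ F j) (p : ∀ j, F j ⟶ X) (hip : ∑ j, i j ≫ p j = 𝟙 X) (n : ℕ)
    (h : ∀ j, Subsingleton (Ext (F j) Y n)) : Subsingleton (Ext X Y n) := by
  refine subsingleton_of_forall_eq 0 fun x => ?_
  rw [← Ext.mk₀_id_comp x, ← hip, Ext.mk₀_sum, Ext.sum_comp]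
  refine Finset.sum_eq_zero fun j _ => ?_
  rw [← Ext.mk₀_comp_mk₀_assoc, Subsingleton.elim ((Ext.mk₀ (p j)).comp x (zero_add n)) 0,
    Ext.comp_zero]

theorem ext_subsingleton_of_sum_right {ι : Type*} [Fintype ι] {X Y : C} {F : ι → C}
    (i : ∀ j, Y ⟶ F j) (p : ∀ j, F j ⟶ Y) (hip : ∑ j, i j ≫ p j = 𝟙 Y) (n : ℕ)
    (h : ∀ j, Subsingleton (Ext X (F j) n)) : Subsingleton (Ext X Y n) := by
  refine subsingleton_of_forall_eq 0 fun x => ?_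
  rw [← Ext.comp_mk₀_id x, ← hip, Ext.mk₀_sum, Ext.comp_sum]
  refine Finset.sum_eq_zero fun j _ => ?_
  rw [← Ext.mk₀_comp_mk₀, ← Ext.comp_assoc_of_third_deg_zero,
    Subsingleton.elim (x.comp (Ext.mk₀ (i j)) (add_zero n)) 0, Ext.zero_comp]

end ExtVanishing

section Add

variable {R : Type u} [Ring R]

theorem sum_ofHom_comp {ι : Type*} [Fintype ι] {X : ModuleCat.{u} R} {F : ι → ModuleCat.{u} R}
    (i : ∀ j, X →ₗ[R] F j) (p : ∀ j, F j →ₗ[R] X) (hip : ∑ j, p j ∘ₗ i j = LinearMap.id) :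
    ∑ j, ModuleCat.ofHom (i j) ≫ ModuleCat.ofHom (p j) = 𝟙 X := by
  apply ModuleCat.hom_ext
  rw [ModuleCat.hom_sum]
  exact hip

theorem inAdd_iff {M X : ModuleCat.{u} R} : InAdd M X ↔
    ∃ (n : ℕ) (i : Fin n → (X →ₗ[R] M)) (p : Fin n → (M →ₗ[R] X)),
      ∑ j, p j ∘ₗ i j = LinearMap.id := by
  constructor
  · rintro ⟨n, i, p, h⟩
    refine ⟨n, fun j => LinearMap.proj j ∘ₗ i, fun j => p ∘ₗ LinearMap.single R (fun _ => M) j, ?_⟩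
    ext x
    conv_rhs => rw [← h]
    simp only [LinearMap.sum_apply, LinearMap.comp_apply, ← map_sum]
    congr 1
    exact LinearMap.sum_single_apply _ _
  · rintro ⟨n, i, p, h⟩
    refine ⟨n, LinearMap.pi i, ∑ j, p j ∘ₗ LinearMap.proj j, ?_⟩
    rw [← h]
    ext x
    simp

theorem IsDirectSummand.inAdd {X M : ModuleCat.{u} R} (h : IsDirectSummand X M) : InAdd M X := by
  obtain ⟨i, p, h⟩ := h
  exact inAdd_iff.2 ⟨1, fun _ => i, fun _ => p, by simpa using h⟩

theorem inAdd_pi (M : ModuleCat.{u} R) (n : ℕ) : InAdd M (ModuleCat.of R (Fin n → M)) :=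
  ⟨n, LinearMap.id, LinearMap.id, rfl⟩

end Add

/-! ### Counting isomorphism classes -/

section Counting

variable {R : Type u} [Ring R]

theorem le_numIsoClasses_of_family {ι : Type*} [Fintype ι] {S : Set (ModuleCat.{u} R)}
    (F : ι → ModuleCat.{u} R) (hF : ∀ i, F i ∈ S)
    (hinj : ∀ i j, Nonempty (F i ≃ₗ[R] F j) → i = j) : (Fintype.card ι : ℕ∞) ≤ numIsoClasses S := by
  let f : ι → Quotient (isIsomorphicSetoid (ModuleCat.{u} R)) := fun i => Quotient.mk _ (F i)
  have hf : Function.Injective f := fun i j h => by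
    obtain ⟨e⟩ : Nonempty (F i ≅ F j) := Quotient.exact h
    exact hinj i j ⟨e.toLinearEquiv⟩
  calc (Fintype.card ι : ℕ∞) = (Set.univ : Set ι).encard := by simp
    _ = (Set.range f).encard := by rw [← Set.image_univ, hf.encard_image]
    _ ≤ numIsoClasses S := by
      apply Set.encard_le_encard
      rintro _ ⟨i, rfl⟩
      exact ⟨F i, hF i, rfl⟩

theorem exists_family_of_le_numIsoClasses {S : Set (ModuleCat.{u} R)} {n : ℕ}
    (h : (n : ℕ∞) ≤ numIsoClasses S) : ∃ F : Fin n → ModuleCat.{u} R, (∀ i, F i ∈ S) ∧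
      ∀ i j, Nonempty (F i ≃ₗ[R] F j) → i = j := by
  obtain ⟨t, ht, hn⟩ := Set.exists_subset_encard_eq h
  have hfin : t.Finite := Set.finite_of_encard_eq_coe hn
  have hcard : t.ncard = n := by
    rw [Set.ncard, hn]; simp
  have := hfin.fintype
  have e : Fin n ≃ t := (Fintype.equivFinOfCardEq (by
    rw [← hcard, Set.ncard_eq_toFinset_card', Set.toFinset_card])).symm
  choose F hF hF' using fun x : t => ht x.2
  refine ⟨fun i => F (e i), fun i => hF _, fun i j hij => ?_⟩
  obtain ⟨f⟩ := hij
  apply e.injective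
  apply Subtype.ext
  rw [← hF' (e i), ← hF' (e j)]
  exact Quotient.sound ⟨f.toModuleIso⟩

end Counting

/-! ### The functor `Hom(M, -)` to modules over the endomorphism ring -/

section HomFunctor

variable {R : Type u} [Ring R]

/-- The right action of the endomorphism ring of `M` on `Hom(M, X)` by precomposition, as a module
structure over the opposite ring. -/
@[reducible] def homModule (M X : Type u) [AddCommGroup M] [Module R M] [AddCommGroup X]
    [Module R X] : Module (Module.End R M)ᵐᵒᵖ (M →ₗ[R] X) where
  smul g f := f ∘ₗ g.unop
  one_smul f := rfl
  mul_smul g h f := rfl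
  smul_zero g := by
    change (0 : M →ₗ[R] X) ∘ₗ g.unop = 0
    exact LinearMap.zero_comp _
  smul_add g f f' := by
    change (f + f') ∘ₗ g.unop = f ∘ₗ g.unop + f' ∘ₗ g.unop
    exact LinearMap.add_comp _ _ _
  add_smul g h f := by
    change f ∘ₗ (g.unop + h.unop) = f ∘ₗ g.unop + f ∘ₗ h.unop
    exact LinearMap.comp_add _ _ _
  zero_smul f := by
    change f ∘ₗ (0 : M →ₗ[R] M) = 0
    exact LinearMap.comp_zero _

attribute [local instance] homModule

variable (M : Type u) [AddCommGroup M] [Module R M]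
variable {X Y : Type u} [AddCommGroup X] [Module R X] [AddCommGroup Y] [Module R Y]

/-- The map `Hom(M, X) → Hom(M, Y)` induced by `f : X → Y`. -/
def homMap (f : X →ₗ[R] Y) : (M →ₗ[R] X) →ₗ[(Module.End R M)ᵐᵒᵖ] (M →ₗ[R] Y) where
  toFun g := f ∘ₗ g
  map_add' _ _ := LinearMap.comp_add _ _ _
  map_smul' _ _ := rfl

/-- An isomorphism `X ≃ Y` induces `Hom(M, X) ≃ Hom(M, Y)`. -/
def homEquiv (e : X ≃ₗ[R] Y) : (M →ₗ[R] X) ≃ₗ[(Module.End R M)ᵐᵒᵖ] (M →ₗ[R] Y) :=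
  LinearEquiv.ofLinearMap (homMap M e.toLinearMap) (homMap M e.symm.toLinearMap)
    (by ext f x; simp [homMap]) (by ext f x; simp [homMap])

/-- The functor `Hom(M, -)` is left exact. -/
noncomputable def homKerEquiv (f : X →ₗ[R] Y) :
    (M →ₗ[R] LinearMap.ker f) ≃ₗ[(Module.End R M)ᵐᵒᵖ] LinearMap.ker (homMap M f) :=
  LinearEquiv.ofBijective ((homMap M (LinearMap.ker f).subtype).codRestrict _ (by
      intro g
      rw [LinearMap.mem_ker]
      ext x
      exact (g x).2)) (by
    constructor
    · intro g h hgh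
      ext x
      exact LinearMap.congr_fun (congrArg Subtype.val hgh) x
    · rintro ⟨g, hg⟩
      exact ⟨g.codRestrict _ (fun x => LinearMap.congr_fun (LinearMap.mem_ker.1 hg) x),
        Subtype.ext (by ext x; rfl)⟩)

/-- `Hom(M, Mⁿ)` is a free module over the endomorphism ring. -/
instance projective_hom_pi (n : ℕ) :
    Module.Projective (Module.End R M)ᵐᵒᵖ (M →ₗ[R] (Fin n → M)) := by
  let e : (Fin n → (Module.End R M)ᵐᵒᵖ) ≃ₗ[(Module.End R M)ᵐᵒᵖ] (M →ₗ[R] (Fin n → M)) :=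
    { toFun := fun f => LinearMap.pi fun j => (f j).unop
      invFun := fun f j => MulOpposite.op (LinearMap.proj j ∘ₗ f)
      left_inv := fun f => rfl
      right_inv := fun f => rfl
      map_add' := fun f g => rfl
      map_smul' := fun f g => rfl }
  exact Module.Projective.of_equiv e

/-- If `X` is a direct summand of some `Mⁿ`, then `Hom(M, X)` is projective. -/
theorem projective_hom_of_retract {n : ℕ} (i : X →ₗ[R] (Fin n → M)) (p : (Fin n → M) →ₗ[R] X)
    (h : p ∘ₗ i = LinearMap.id) : Module.Projective (Module.End R M)ᵐᵒᵖ (M →ₗ[R] X) := by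
  refine Module.Projective.of_split (homMap M i) (homMap M p) ?_
  ext f x
  exact LinearMap.congr_fun h (f x)

/-- If `M` is a generator, then the functor `Hom(M, -)` is full: the image of `x : X` under the
preimage of `s` is read off from the values of `s` at the composites `M → R → X`, where `R → X`
sends `1` to `x`. -/
theorem exists_eq_homMap {n : ℕ} (i : Fin n → (R →ₗ[R] M)) (p : Fin n → (M →ₗ[R] R))
    (hip : ∑ j, p j ∘ₗ i j = LinearMap.id)
    (s : (M →ₗ[R] X) →ₗ[(Module.End R M)ᵐᵒᵖ] (M →ₗ[R] Y)) : ∃ f : X →ₗ[R] Y, s = homMap M f := by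
  let ρ : X → (R →ₗ[R] X) := fun x => LinearMap.toSpanSingleton R X x
  have hs : ∀ (g : M →ₗ[R] X) (t : M →ₗ[R] M), s (g ∘ₗ t) = s g ∘ₗ t := fun g t =>
    s.map_smul (MulOpposite.op t) g
  have hip' : ∀ r, ∑ j, p j (i j r) = r := fun r => by
    have := LinearMap.congr_fun hip r
    simpa using this
  -- for a map `M → X` factoring through `t : M → R`, expand `t` along `1 = ∑ p l ∘ i l`
  have key : ∀ (x : X) (t : M →ₗ[R] R) (m : M),
      s (ρ x ∘ₗ t) m = ∑ l, s (ρ x ∘ₗ p l) (i l (t m)) := by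
    intro x t m
    have h1 : ρ x ∘ₗ t = ∑ l, (ρ x ∘ₗ p l) ∘ₗ (i l ∘ₗ t) := by
      ext y
      simp only [LinearMap.comp_apply, LinearMap.sum_apply, ← map_sum, hip']
    rw [h1, map_sum, LinearMap.sum_apply]
    exact Finset.sum_congr rfl fun l _ => by rw [hs]; rfl
  let f : X →ₗ[R] Y :=
    { toFun := fun x => ∑ j, s (ρ x ∘ₗ p j) (i j 1)
      map_add' := fun x y => by
        rw [← Finset.sum_add_distrib]
        refine Finset.sum_congr rfl fun j _ => ?_
        have : ρ (x + y) ∘ₗ p j = ρ x ∘ₗ p j + ρ y ∘ₗ p j := by ext; simp [ρ]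
        rw [this, map_add, LinearMap.add_apply]
      map_smul' := fun r x => by
        have h1 : ∀ j, s (ρ (r • x) ∘ₗ p j) (i j 1) =
            ∑ l, s (ρ x ∘ₗ p l) (i l (p j (i j 1) * r)) := by
          intro j
          have h2 : ρ (r • x) ∘ₗ p j = ρ x ∘ₗ (LinearMap.toSpanSingleton R R r ∘ₗ p j) := by
            ext; simp [ρ, mul_smul]
          rw [h2, key]
          simp
        simp_rw [h1]
        rw [Finset.sum_comm, RingHom.id_apply, Finset.smul_sum]
        refine Finset.sum_congr rfl fun l _ => ?_
        rw [← map_sum, ← map_sum, ← Finset.sum_mul, hip', one_mul, ← map_smul, ← map_smul,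
          smul_eq_mul, mul_one] }
  refine ⟨f, ?_⟩
  ext g m
  -- write `m` as the value at `1` of a map `t : R → M`
  let t : R →ₗ[R] M := LinearMap.toSpanSingleton R M m
  have h1 : ∀ j, ρ (g m) ∘ₗ p j = g ∘ₗ (t ∘ₗ p j) := by
    intro j; ext; simp [ρ, t]
  change s g m = ∑ j, s (ρ (g m) ∘ₗ p j) (i j 1)
  simp_rw [h1, hs]
  simp only [LinearMap.comp_apply, ← map_sum, hip']
  simp [t]

end HomFunctor

/-! ### Bounding the size of rigid modules -/

section UpperBound

attribute [local instance] homModule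

variable {K R : Type u} [Field K] [Ring R] [Algebra K R]

/-- The vector space structure on a module over a `K`-algebra. -/
@[reducible] def vectorSpaceOfModule (K : Type u) {R : Type u} [Field K] [Ring R] [Algebra K R]
    (X : Type u) [AddCommGroup X] [Module R X] : Module K X :=
  Module.compHom X (algebraMap K R)

theorem isScalarTower_vectorSpaceOfModule (X : Type u) [AddCommGroup X] [Module R X] :
    letI := vectorSpaceOfModule K (R := R) X
    IsScalarTower K R X :=
  letI := vectorSpaceOfModule K (R := R) X
  ⟨fun a r x => by rw [Algebra.smul_def, mul_smul]; rfl⟩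

variable (K) in
/-- Every map from `M` to `X` factors through a suitable map `Mⁿ → X`. -/
theorem exists_hom_approximation [Module.Finite K R] (M X : Type u) [AddCommGroup M] [Module R M]
    [AddCommGroup X] [Module R X] [Module.Finite R M] [Module.Finite R X] :
    ∃ (n : ℕ) (q : (Fin n → M) →ₗ[R] X), ∀ h : M →ₗ[R] X, ∃ g, q ∘ₗ g = h := by
  let _ := vectorSpaceOfModule K (R := R) M
  have := isScalarTower_vectorSpaceOfModule (K := K) (R := R) M
  let _ := vectorSpaceOfModule K (R := R) X
  have := isScalarTower_vectorSpaceOfModule (K := K) (R := R) X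
  have : Module.Finite K M := Module.Finite.trans R M
  have : Module.Finite K X := Module.Finite.trans R X
  have := finite_hom_of_tower K (Γ := R) (X := M) (Y := X)
  let b := Module.finBasis K (M →ₗ[R] X)
  refine ⟨_, ∑ m, b m ∘ₗ LinearMap.proj m, fun h =>
    ⟨LinearMap.pi fun m => b.repr h m • LinearMap.id, ?_⟩⟩
  ext x
  conv_rhs => rw [← b.sum_repr h]
  simp only [LinearMap.comp_apply, LinearMap.sum_apply, LinearMap.smul_apply, LinearMap.proj_apply,
    LinearMap.pi_apply, LinearMap.id_apply]
  exact Finset.sum_congr rfl fun m _ => ((b m).restrictScalars K).map_smul _ _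

/-- A map `q` from `Mⁿ` through which all maps from `M` factor is surjective when `M` is a
generator. -/
theorem surjective_of_approximation {M : Type u} [AddCommGroup M] [Module R M] {n : ℕ}
    (i : Fin n → (R →ₗ[R] M)) (p : Fin n → (M →ₗ[R] R)) (hip : ∑ j, p j ∘ₗ i j = LinearMap.id)
    {X N : Type u} [AddCommGroup X] [Module R X] [AddCommGroup N] [Module R N]
    (q : N →ₗ[R] X) (hq : ∀ h : M →ₗ[R] X, ∃ g, q ∘ₗ g = h) : Function.Surjective q := by
  intro x
  choose g hg using fun j => hq (LinearMap.toSpanSingleton R X x ∘ₗ p j)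
  refine ⟨∑ j, g j (i j 1), ?_⟩
  have h1 := LinearMap.congr_fun hip (1 : R)
  simp only [LinearMap.sum_apply, LinearMap.comp_apply, LinearMap.id_apply] at h1
  have h2 : ∀ j, q (g j (i j 1)) = LinearMap.toSpanSingleton R X x (p j (i j 1)) := fun j =>
    LinearMap.congr_fun (hg j) _
  rw [map_sum]
  simp_rw [h2]
  rw [← map_sum, h1]
  simp

/-- The hypothesis on a module `M` from which rigid modules get bounded sizes: `M` is a finitely
generated generator and `Hom(M, X)` has projective dimension at most one over `End(M)`, for every
finitely generated `X`. The projective presentation of `Hom(M, X)` is induced by an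
approximation `Mⁿ → X`. -/
structure HasShortHomResolutions (M : ModuleCat.{u} R) : Prop where
  finite : Module.Finite R M
  generator : InAdd M (ModuleCat.of R R)
  resolution : ∀ (X : ModuleCat.{u} R), Module.Finite R X →
    ∃ (n : ℕ) (q : (Fin n → M) →ₗ[R] X), (∀ h : M →ₗ[R] X, ∃ g, q ∘ₗ g = h) ∧
      Module.Projective (Module.End R M)ᵐᵒᵖ (M →ₗ[R] LinearMap.ker q)

variable (K) in
/-- Over a finite-dimensional algebra, the sizes of the rigid modules are bounded by the number of
simple modules over `End(M)`: if `X` is rigid, then `Hom(M, X)` is a partial tilting module. -/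
theorem HasShortHomResolutions.exists_rigidSize_le [Module.Finite K R] {M : ModuleCat.{u} R}
    (hM : HasShortHomResolutions M) : ∃ m : ℕ, rigidSize R 1 ≤ m := by
  have := hM.finite
  let _ := vectorSpaceOfModule K (R := R) M
  have := isScalarTower_vectorSpaceOfModule (K := K) (R := R) M
  have : Module.Finite K M := Module.Finite.trans R M
  have : Module.Finite K (Module.End R M) := finite_hom_of_tower K (Γ := R) (X := M) (Y := M)
  have hΓ : Module.Finite K (Module.End R M)ᵐᵒᵖ :=
    Module.Finite.equiv (MulOpposite.opLinearEquiv K)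
  have hA : IsArtinian (Module.End R M)ᵐᵒᵖ (Module.End R M)ᵐᵒᵖ :=
    isArtinian_of_tower K (inferInstance : IsArtinian K (Module.End R M)ᵐᵒᵖ)
  have hN : IsNoetherian (Module.End R M)ᵐᵒᵖ (Module.End R M)ᵐᵒᵖ :=
    isNoetherian_of_tower K (inferInstance : IsNoetherian K (Module.End R M)ᵐᵒᵖ)
  have hRA : IsArtinianRing R := isArtinian_of_tower K (inferInstance : IsArtinian K R)
  have hRN : IsNoetherianRing R := isNoetherian_of_tower K (inferInstance : IsNoetherian K R)
  obtain ⟨κ, _, S, -, hS⟩ := exists_finite_simple_family (Module.End R M)ᵐᵒᵖ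
  refine ⟨Fintype.card κ, iSup_le fun X => iSup_le fun hX => iSup_le fun hrigid => ?_⟩
  by_contra hlt
  obtain ⟨F, hF, hinj⟩ := exists_family_of_le_numIsoClasses (n := Fintype.card κ + 1)
    (S := {Y : ModuleCat.{u} R | Indecomposable Y ∧ IsDirectSummand Y X}) (by
      rw [Nat.cast_add, Nat.cast_one]
      exact Order.add_one_le_of_lt (not_le.1 hlt))
  have hfin : ∀ i, Module.Finite R (F i) := fun i => by
    obtain ⟨j, p, h⟩ := (hF i).2
    exact Module.Finite.of_surjective p (fun x => ⟨j x, LinearMap.congr_fun h x⟩)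
  let _ : ∀ i, Module K (F i) := fun i => vectorSpaceOfModule K (R := R) (F i)
  have : ∀ i, IsScalarTower K R (F i) := fun i => isScalarTower_vectorSpaceOfModule (F i)
  have hFfin : ∀ i, Module.Finite K (F i) := fun i => Module.Finite.trans R (F i)
  choose n q hq hproj using fun i => hM.resolution (F i) (hfin i)
  obtain ⟨l, gi, gp, hg⟩ := inAdd_iff.1 hM.generator
  have hqs : ∀ i, Function.Surjective (q i) := fun i =>
    surjective_of_approximation gi gp hg (q i) (hq i)
  let T : Fin (Fintype.card κ + 1) → Type u := fun i => M →ₗ[R] F i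
  let P : Fin (Fintype.card κ + 1) → Type u := fun i => M →ₗ[R] (Fin (n i) → M)
  have hTt : ∀ i, IsScalarTower K (Module.End R M)ᵐᵒᵖ (M →ₗ[R] F i) := fun i =>
    ⟨fun a g f => by
      ext x
      exact (f.restrictScalars K).map_smul a (g.unop x)⟩
  have hPt : ∀ i, IsScalarTower K (Module.End R M)ᵐᵒᵖ (M →ₗ[R] (Fin (n i) → M)) := fun i =>
    ⟨fun a g f => LinearMap.ext fun x => (f.restrictScalars K).map_smul a (g.unop x)⟩
  have hTf : ∀ i, Module.Finite K (M →ₗ[R] F i) := fun i => finite_hom_of_tower K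
  have hPf : ∀ i, Module.Finite K (M →ₗ[R] (Fin (n i) → M)) := fun i => finite_hom_of_tower K
  have hker : ∀ i, Module.Projective (Module.End R M)ᵐᵒᵖ (LinearMap.ker (homMap M (q i))) :=
    fun i => Module.Projective.of_equiv (homKerEquiv M (q i))
  have hext : ∀ i j, ExtendsAlong (homMap M (q i)) (M →ₗ[R] F j) := by
    intro i j f
    obtain ⟨σ, hσ⟩ := exists_eq_homMap M gi gp hg (f ∘ₗ (homKerEquiv M (q i)).toLinearMap)
    have hE := hrigid (F i) (F j) (hF i).2.inAdd (hF j).2.inAdd 1 le_rfl le_rfl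
    have hsh := LinearMap.shortExact_shortComplexKer (h := hqs i)
    obtain ⟨σ', hσ'⟩ := @exists_extension_of_ext_one _ _ _ _ _ hsh (F j) hE (ModuleCat.ofHom σ)
    refine ⟨homMap M σ'.hom, fun x => ?_⟩
    obtain ⟨y, rfl⟩ := (homKerEquiv M (q i)).surjective x
    have h1 : f (homKerEquiv M (q i) y) = homMap M σ y := LinearMap.congr_fun hσ y
    rw [h1]
    ext m
    exact LinearMap.congr_fun (congrArg ModuleCat.Hom.hom hσ') (y m)
  obtain ⟨i₀, α, _, d, f, p, hd, hsum⟩ := exists_summand_of_card_lt (K := K)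
    (Γ := (Module.End R M)ᵐᵒᵖ) (P := P) (T := T) (fun i => homMap M (q i)) (fun i => hq i) hext
    S hS (by simp)
  choose f' hf' using fun a => exists_eq_homMap M gi gp hg (f a)
  choose p' hp' using fun a => exists_eq_homMap M gi gp hg (p a)
  have hsum' : ∑ a, p' a ∘ₗ f' a = LinearMap.id := by
    -- faithfulness: evaluate at the maps `M → R → F i₀`
    ext x
    have h1 := LinearMap.congr_fun hg (1 : R)
    simp only [LinearMap.sum_apply, LinearMap.comp_apply, LinearMap.id_apply] at h1
    have h2 : ∀ j, (∑ a, p' a ∘ₗ f' a) (LinearMap.toSpanSingleton R (F i₀) x (gp j (gi j 1))) =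
        LinearMap.toSpanSingleton R (F i₀) x (gp j (gi j 1)) := by
      intro j
      have h3 := LinearMap.congr_fun (LinearMap.congr_fun hsum
        (LinearMap.toSpanSingleton R (F i₀) x ∘ₗ gp j)) (gi j 1)
      simp only [hf', hp', LinearMap.sum_apply, LinearMap.comp_apply, LinearMap.id_apply] at h3
      have h5 := LinearMap.sum_apply Finset.univ (fun a => (p' a ∘ₗ f' a) ∘ₗ
        (LinearMap.toSpanSingleton R (F i₀) x ∘ₗ gp j)) (gi j 1)
      rw [LinearMap.sum_apply]
      exact h5.symm.trans h3
    have h4 : LinearMap.toSpanSingleton R (F i₀) x (∑ j, gp j (gi j 1)) = x := by rw [h1]; simp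
    rw [← h4, map_sum, map_sum, map_sum]
    exact Finset.sum_congr rfl fun j _ => h2 j
  have hind : ∀ i, HasTrivialIdempotents R (F i) := fun i =>
    HasTrivialIdempotents.of_indecomposable (hF i).1
  have : IsArtinian R (F i₀) := inferInstance
  obtain ⟨a, ha⟩ := (hind i₀).exists_linearEquiv (fun a => hind (d a)) f' p' hsum'
  exact hd a (hinj _ _ ha).symm

end UpperBound

/-! ### Coinduced modules -/

section Coinduced

variable {K R : Type u} [Field K] [Ring R] [Algebra K R]

/-- The coinduced module `Hom_K(R, V)`. It is kept apart from the type of linear maps, on which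
`R` may act through `V`. -/
def Coinduced (K R : Type u) [Field K] [Ring R] [Algebra K R] (V : Type u) [AddCommGroup V]
    [Module K V] : Type u :=
  R →ₗ[K] V

variable {V : Type u} [AddCommGroup V] [Module K V]

instance : AddCommGroup (Coinduced K R V) := inferInstanceAs (AddCommGroup (R →ₗ[K] V))

instance : Module K (Coinduced K R V) := inferInstanceAs (Module K (R →ₗ[K] V))

instance : FunLike (Coinduced K R V) R V := inferInstanceAs (FunLike (R →ₗ[K] V) R V)

theorem Coinduced.ext {f g : Coinduced K R V} (h : ∀ s : R, f s = g s) : f = g :=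
  LinearMap.ext (f := (f : R →ₗ[K] V)) h

theorem Coinduced.map_add' (f : Coinduced K R V) (s t : R) : f (s + t) = f s + f t :=
  LinearMap.map_add (f : R →ₗ[K] V) s t

theorem Coinduced.map_smul' (f : Coinduced K R V) (a : K) (s : R) : f (a • s) = a • f s :=
  LinearMap.map_smul (f : R →ₗ[K] V) a s

/-- The ring acts by `(r • f)(s) = f (s * r)`. -/
instance : Module R (Coinduced K R V) where
  smul r f := LinearMap.comp f (LinearMap.mulRight K r)
  one_smul f := Coinduced.ext fun s => by
    change f (s * 1) = f s
    rw [mul_one]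
  mul_smul r r' f := Coinduced.ext fun s => by
    change f (s * (r * r')) = f ((s * r) * r')
    rw [mul_assoc]
  smul_zero r := rfl
  smul_add r f g := rfl
  add_smul r r' f := Coinduced.ext fun s => by
    change f (s * (r + r')) = f (s * r) + f (s * r')
    rw [mul_add, f.map_add']
  zero_smul f := Coinduced.ext fun s => by
    change f (s * 0) = 0
    rw [mul_zero]
    exact LinearMap.map_zero (f : R →ₗ[K] V)

theorem Coinduced.smul_apply (r : R) (f : Coinduced K R V) (s : R) : (r • f) s = f (s * r) := rfl

instance : IsScalarTower K R (Coinduced K R V) :=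
  ⟨fun a r f => Coinduced.ext fun s => by
    change f (s * (a • r)) = a • f (s * r)
    rw [mul_smul_comm, f.map_smul']⟩

instance [Module.Finite K R] [Module.Finite K V] : Module.Finite R (Coinduced K R V) := by
  have : Module.Finite K (Coinduced K R V) := inferInstanceAs (Module.Finite K (R →ₗ[K] V))
  exact Module.Finite.of_restrictScalars_finite K R _

instance injective_coinduced : Module.Injective R (Coinduced K R V) := by
  refine ⟨fun X Y _ _ _ _ i hi g => ?_⟩
  let _ := vectorSpaceOfModule K (R := R) X
  have := isScalarTower_vectorSpaceOfModule (K := K) (R := R) X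
  let _ := vectorSpaceOfModule K (R := R) Y
  have := isScalarTower_vectorSpaceOfModule (K := K) (R := R) Y
  have hg : ∀ (r s : R) (x : X), g (r • x) s = g x (s * r) := fun r s x => by
    rw [g.map_smul, Coinduced.smul_apply]
  -- extend the composite of `g` with evaluation at `1`
  let φ : X →ₗ[K] V :=
    { toFun := fun x => g x 1
      map_add' := fun x y => by rw [map_add]; rfl
      map_smul' := fun a x => by
        rw [← algebraMap_smul R a x, hg, one_mul, Algebra.algebraMap_eq_smul_one,
          Coinduced.map_smul']
        rfl }
  obtain ⟨ψ, hψ⟩ := LinearMap.exists_leftInverse_of_injective (i.restrictScalars K)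
    (LinearMap.ker_eq_bot.2 hi)
  refine ⟨{ toFun := fun y =>
              φ ∘ₗ ψ ∘ₗ (LinearMap.toSpanSingleton R Y y).restrictScalars K
            map_add' := fun x y => Coinduced.ext fun s => by
              change φ (ψ (s • (x + y))) = φ (ψ (s • x)) + φ (ψ (s • y))
              rw [smul_add, map_add, map_add]
            map_smul' := fun r y => Coinduced.ext fun s => by
              change φ (ψ (s • r • y)) = φ (ψ ((s * r) • y))
              rw [mul_smul] }, fun x => Coinduced.ext fun s => ?_⟩
  change φ (ψ (s • i x)) = g x s
  rw [← map_smul]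
  have h1 : ψ (i (s • x)) = s • x := LinearMap.congr_fun hψ _
  rw [h1]
  change g (s • x) 1 = g x s
  rw [hg, one_mul]

variable (K) in
/-- Every finitely generated module over a finite-dimensional algebra embeds into a finitely
generated injective module. -/
theorem exists_finite_injective_embedding [Module.Finite K R] (X : Type u) [AddCommGroup X]
    [Module R X] [Module.Finite R X] : ∃ (I : ModuleCat.{u} R) (f : X →ₗ[R] I),
      Module.Finite R I ∧ Module.Injective R I ∧ Function.Injective f := by
  let _ := vectorSpaceOfModule K (R := R) X
  have := isScalarTower_vectorSpaceOfModule (K := K) (R := R) X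
  have : Module.Finite K X := Module.Finite.trans R X
  refine ⟨ModuleCat.of R (Coinduced K R X),
    { toFun := fun x => (LinearMap.toSpanSingleton R X x).restrictScalars K
      map_add' := fun x y => Coinduced.ext fun s => smul_add s x y
      map_smul' := fun r x => Coinduced.ext fun s => by
        change s • r • x = (s * r) • x
        rw [mul_smul] },
    inferInstanceAs (Module.Finite R (Coinduced K R X)), injective_coinduced, ?_⟩
  intro x y hxy
  have h1 : (1 : R) • x = (1 : R) • y := congrArg (fun f : Coinduced K R X => f 1) hxy
  simpa using h1

end Coinduced

/-! ### Two sources of short resolutions -/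

section Resolutions

attribute [local instance] homModule

variable {K R : Type u} [Field K] [Ring R] [Algebra K R]

theorem hasProjectiveDimensionLT_ker {Y Z : Type u} [AddCommGroup Y] [Module R Y]
    [AddCommGroup Z] [Module R Z] [Module.Projective R Y] {f : Y →ₗ[R] Z}
    (hf : Function.Surjective f) {n : ℕ} (hn : 1 ≤ n)
    (h : HasProjectiveDimensionLT (ModuleCat.of R Z) (n + 1)) :
    HasProjectiveDimensionLT (ModuleCat.of R (LinearMap.ker f)) n :=
  (LinearMap.shortExact_shortComplexKer hf).hasProjectiveDimensionLT_X₁ n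
    (hasProjectiveDimensionLT_of_ge (ModuleCat.of R Y) 1 n hn) h

variable (K) in
/-- If `M` is a generator-cogenerator and `End(M)` has global dimension at most three, then each
`Hom(M, X)`, being a second syzygy, has projective dimension at most one. -/
theorem hasShortHomResolutions_of_globalDim_le [Module.Finite K R] {M : ModuleCat.{u} R}
    (hM : IsGeneratorCogenerator M) (hgl : globalDim (Module.End R M)ᵐᵒᵖ ≤ 3) :
    HasShortHomResolutions M where
  finite := hM.1
  generator := hM.2 (ModuleCat.of R R) (inferInstanceAs (Module.Finite R R))
    (Or.inl (inferInstanceAs (Module.Projective R R)))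
  resolution X hX := by
    have := hM.1
    obtain ⟨n, q, hq⟩ := exists_hom_approximation K (R := R) M X
    refine ⟨n, q, hq, ?_⟩
    obtain ⟨I₀, f, hI₀, hI₀', hf⟩ := exists_finite_injective_embedding K (R := R) X
    obtain ⟨I₁, g, hI₁, hI₁', hg⟩ :=
      exists_finite_injective_embedding K (R := R) (I₀ ⧸ LinearMap.range f)
    obtain ⟨_, i₀, p₀, h₀⟩ := hM.2 I₀ hI₀ (Or.inr hI₀')
    obtain ⟨_, i₁, p₁, h₁⟩ := hM.2 I₁ hI₁ (Or.inr hI₁')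
    have := projective_hom_of_retract M i₀ p₀ h₀
    have := projective_hom_of_retract M i₁ p₁ h₁
    let δ : I₀ →ₗ[R] I₁ := g ∘ₗ (LinearMap.range f).mkQ
    have hδ : LinearMap.ker δ = LinearMap.range f := by
      rw [LinearMap.ker_comp, LinearMap.ker_eq_bot.2 hg, Submodule.comap_bot, Submodule.ker_mkQ]
    let φ := homMap M δ
    have hpd4 : HasProjectiveDimensionLT (ModuleCat.of (Module.End R M)ᵐᵒᵖ
        ((M →ₗ[R] I₁) ⧸ LinearMap.range φ)) 4 := by
      rw [← projectiveDimension_lt_iff]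
      exact lt_of_le_of_lt ((le_iSup _ _).trans hgl) (by norm_num)
    have hpd3 : HasProjectiveDimensionLT
        (ModuleCat.of (Module.End R M)ᵐᵒᵖ (LinearMap.range φ)) 3 := by
      have := hasProjectiveDimensionLT_ker (Submodule.mkQ_surjective (LinearMap.range φ))
        (n := 3) (by norm_num) hpd4
      exact hasProjectiveDimensionLT_of_iso
        (LinearEquiv.ofEq _ _ (Submodule.ker_mkQ (LinearMap.range φ))).toModuleIso 3
    have hpd2 : HasProjectiveDimensionLT (ModuleCat.of (Module.End R M)ᵐᵒᵖ (M →ₗ[R] X)) 2 := by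
      have := hasProjectiveDimensionLT_ker φ.surjective_rangeRestrict (n := 2) (by norm_num) hpd3
      rw [LinearMap.ker_rangeRestrict] at this
      let e : (M →ₗ[R] X) ≃ₗ[(Module.End R M)ᵐᵒᵖ] LinearMap.ker φ :=
        homEquiv M (LinearEquiv.ofInjective f hf) ≪≫ₗ
        homEquiv M (LinearEquiv.ofEq _ _ hδ.symm) ≪≫ₗ homKerEquiv M δ
      exact hasProjectiveDimensionLT_of_iso e.symm.toModuleIso 2
    have hpd1 := hasProjectiveDimensionLT_ker (f := homMap M q) hq (n := 1) le_rfl hpd2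
    have hproj := projective_iff_hasProjectiveDimensionLT_one.2 hpd1
    rw [← IsProjective.iff_projective] at hproj
    exact Module.Projective.of_equiv (homKerEquiv M q).symm

variable (K) in
/-- For a maximal orthogonal module `M`, the kernel of an approximation `Mⁿ → X` is orthogonal to
`M`, hence a direct summand of a power of `M`. -/
theorem IsMaximalOrthogonal.hasShortHomResolutions [Module.Finite K R] {M : ModuleCat.{u} R}
    (hM : IsMaximalOrthogonal 1 M) : HasShortHomResolutions M := by
  have hgen : InAdd M (ModuleCat.of R R) := by
    refine ((hM.2 _ (inferInstanceAs (Module.Finite R R))).2).2 fun i hi _ => ?_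
    have : Projective (ModuleCat.of R R) :=
      (IsProjective.iff_projective R).1 (inferInstanceAs (Module.Projective R R))
    obtain ⟨i, rfl⟩ := Nat.exists_eq_add_of_le' hi
    exact subsingleton_of_forall_eq 0 fun x => x.eq_zero_of_projective
  refine ⟨hM.1, hgen, fun X hX => ?_⟩
  have := hM.1
  have hRN : IsNoetherianRing R := isNoetherian_of_tower K (inferInstance : IsNoetherian K R)
  obtain ⟨n, q, hq⟩ := exists_hom_approximation K (R := R) M X
  refine ⟨n, q, hq, ?_⟩
  obtain ⟨l, gi, gp, hg⟩ := inAdd_iff.1 hgen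
  have hqs := surjective_of_approximation gi gp hg q hq
  have hS := LinearMap.shortExact_shortComplexKer hqs
  have hext : Subsingleton (Abelian.Ext M (ModuleCat.of R (Fin n → M)) 1) :=
    ((hM.2 (ModuleCat.of R (Fin n → M)) (inferInstanceAs (Module.Finite R (Fin n → M)))).1).1
      (inAdd_pi M n) 1 le_rfl le_rfl
  have hk : Subsingleton (Abelian.Ext M (ModuleCat.of R (LinearMap.ker q)) 1) := by
    refine @ext_one_subsingleton_of_lift _ _ _ _ _ hS M hext fun f => ?_
    obtain ⟨g, hg⟩ := hq f.hom
    exact ⟨ModuleCat.ofHom g, ModuleCat.hom_ext hg⟩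
  obtain ⟨m, i, p, h⟩ := ((hM.2 (ModuleCat.of R (LinearMap.ker q))
    (inferInstanceAs (Module.Finite R (LinearMap.ker q)))).1).2 (fun j hj hj' => by
      obtain rfl : j = 1 := le_antisymm hj' hj
      exact hk)
  exact projective_hom_of_retract M i p h

variable (K R) in
theorem exists_rigidSize_le [Module.Finite K R]
    (h : representationDim R ≤ 3 ∨ ∃ M : ModuleCat.{u} R, IsMaximalOrthogonal 1 M) :
    ∃ m : ℕ, rigidSize R 1 ≤ m := by
  rcases h with h | ⟨M, hM⟩
  · have h4 : representationDim R < 4 := lt_of_le_of_lt h (by norm_num)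
    rw [representationDim, iInf_lt_iff] at h4
    obtain ⟨M, hM⟩ := h4
    rw [iInf_lt_iff] at hM
    obtain ⟨hM, hgl⟩ := hM
    have hgl' : globalDim (Module.End R M)ᵐᵒᵖ ≤ 3 := by
      have h34 : (4 : WithBot ℕ∞) = ((3 : ℕ) : WithBot ℕ∞) + 1 := by norm_num
      rw [h34, ENat.WithBot.lt_add_one_iff] at hgl
      exact hgl
    exact (hasShortHomResolutions_of_globalDim_le K hM hgl').exists_rigidSize_le K
  · exact (hM.hasShortHomResolutions K).exists_rigidSize_le K

end Resolutions

/-! ### The Nakayama functor on `add (eA)` -/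

section Duality

variable {K A : Type u} [Field K] [Ring A] [Algebra K A]

theorem mem_rightIdeal_iff {e : A} (he : IsIdempotentElem e) {z : A} :
    z ∈ rightIdeal e ↔ e * z = z := by
  rw [Submodule.mem_span_singleton]
  constructor
  · rintro ⟨a, rfl⟩
    change e * (e * a.unop) = e * a.unop
    rw [← mul_assoc, he.eq]
  · intro h
    exact ⟨MulOpposite.op z, h⟩

theorem mem_leftIdeal_iff {e : A} (he : IsIdempotentElem e) {y : A} :
    y ∈ leftIdeal e ↔ y * e = y := by
  rw [Submodule.mem_span_singleton]
  constructor
  · rintro ⟨a, rfl⟩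
    rw [smul_eq_mul, mul_assoc, he.eq]
  · intro h
    exact ⟨y, h⟩

/-- A bimodule isomorphism `eA ≅ D(Ae)` amounts to a linear form on `A` that is symmetric on `eAe`
and induces a perfect pairing between `eA` and `Ae`. -/
theorem DualBimoduleIso.exists_form [Module.Finite K A] {e : A} (he : IsIdempotentElem e)
    (h : DualBimoduleIso K e) : ∃ l : A →ₗ[K] K,
      (∀ x y, e * x = x → x * e = x → e * y = y → y * e = y → l (x * y) = l (y * x)) ∧
      (∀ y, y * e = y → (∀ z, e * z = z → l (z * y) = 0) → y = 0) ∧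
      ∀ g : rightIdeal e →ₗ[K] K, ∃ y, y * e = y ∧ ∀ z : rightIdeal e, g z = l (z * y) := by
  obtain ⟨φ, hφ⟩ := h
  have hle : ∀ x : A, x * e ∈ leftIdeal e := fun x =>
    (mem_leftIdeal_iff he).2 (by rw [mul_assoc, he.eq])
  let e' : rightIdeal e := ⟨e, (mem_rightIdeal_iff he).2 he.eq⟩
  let l : A →ₗ[K] K :=
    { toFun := fun x => φ e' ⟨x * e, hle x⟩
      map_add' := fun x y => by
        rw [← map_add]
        congr 1
        exact Subtype.ext (add_mul _ _ _)
      map_smul' := fun a x => by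
        rw [RingHom.id_apply, ← map_smul]
        congr 1
        exact Subtype.ext (smul_mul_assoc _ _ _) }
  have hl : ∀ (z : rightIdeal e) (y : leftIdeal e), φ z y = l (z * y) := by
    intro z y
    have hz := (mem_rightIdeal_iff he).1 z.2
    refine hφ 1 z e' z y ⟨z * y * e, hle _⟩ ?_ ?_
    · rw [mul_one, he.eq, he.eq, hz]
    · rw [mul_one, he.eq]
  refine ⟨l, ?_, ?_, ?_⟩
  · intro x y hx hx' hy hy'
    rw [← hl ⟨x, (mem_rightIdeal_iff he).2 hx⟩ ⟨y, (mem_leftIdeal_iff he).2 hy'⟩]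
    refine hφ x 1 e' _ _ ⟨y * x * e, hle _⟩ ?_ ?_
    · change x = e * x * e * e * 1
      rw [hx, hx', mul_one, hx']
    · change y * x * e = 1 * y * (e * x * e)
      rw [hx, hx', one_mul, mul_assoc, hx']
  · intro y hy h0
    have h1 : (⟨y, (mem_leftIdeal_iff he).2 hy⟩ : leftIdeal e) = 0 := by
      rw [← Module.forall_dual_apply_eq_zero_iff K]
      intro f
      obtain ⟨z, rfl⟩ := φ.surjective f
      rw [hl]
      exact h0 z ((mem_rightIdeal_iff he).1 z.2)
    exact congrArg Subtype.val h1
  · intro g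
    have : Module.Finite K (leftIdeal e) := finite_submodule_of_tower K _
    obtain ⟨y, hy⟩ := (Module.evalEquiv K (leftIdeal e)).surjective
      (g ∘ₗ φ.symm.toLinearMap)
    refine ⟨y, (mem_leftIdeal_iff he).1 y.2, fun z => ?_⟩
    have h1 := LinearMap.congr_fun hy (φ z)
    rw [← hl]
    simpa using h1.symm

/-- A map `f : I → A` corresponds to a linear form `h` on `I` under the isomorphism
`Hom(I, A) ≅ D(I)`, for `I` in `add (eA)`, determined by a linear form `l` on `A`. -/
def CorrespondsTo {I : Type u} [AddCommGroup I] [Module Aᵐᵒᵖ I] [Module K I]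
    (e : A) (l : A →ₗ[K] K) (f : I →ₗ[Aᵐᵒᵖ] A) (h : I →ₗ[K] K) : Prop :=
  ∀ (v : I) (z : A), MulOpposite.op e • v = v → e * z = z → h (MulOpposite.op z • v) = l (z * f v)

section Correspondence

variable {e : A} {l : A →ₗ[K] K} {I : Type u} [AddCommGroup I] [Module Aᵐᵒᵖ I] [Module K I]
  [IsScalarTower K Aᵐᵒᵖ I] {n : ℕ} {i : Fin n → (I →ₗ[Aᵐᵒᵖ] rightIdeal e)}
  {p : Fin n → (rightIdeal e →ₗ[Aᵐᵒᵖ] I)}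

theorem map_op_smul_eq_mul (f : I →ₗ[Aᵐᵒᵖ] A) (a : A) (v : I) :
    f (MulOpposite.op a • v) = f v * a := by
  rw [map_smul]; rfl

theorem coe_map_op_smul_eq_mul (f : I →ₗ[Aᵐᵒᵖ] rightIdeal e) (a : A) (v : I) :
    (f (MulOpposite.op a • v) : A) = f v * a := by
  rw [map_smul]; rfl

theorem op_smul_generator (he : IsIdempotentElem e) (z : rightIdeal e) :
    MulOpposite.op (z : A) • (⟨e, (mem_rightIdeal_iff he).2 he.eq⟩ : rightIdeal e) = z :=
  Subtype.ext ((mem_rightIdeal_iff he).1 z.2)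

theorem eq_sum_op_smul (he : IsIdempotentElem e) (hip : ∑ j, p j ∘ₗ i j = LinearMap.id) (x : I) :
    x = ∑ j, MulOpposite.op (i j x : A) • p j ⟨e, (mem_rightIdeal_iff he).2 he.eq⟩ := by
  have h1 := LinearMap.congr_fun hip x
  simp only [LinearMap.sum_apply, LinearMap.comp_apply, LinearMap.id_apply] at h1
  conv_lhs => rw [← h1]
  refine Finset.sum_congr rfl fun j _ => ?_
  rw [← map_smul, op_smul_generator he]

theorem op_smul_map_generator (he : IsIdempotentElem e) (q : rightIdeal e →ₗ[Aᵐᵒᵖ] I) :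
    MulOpposite.op e • q ⟨e, (mem_rightIdeal_iff he).2 he.eq⟩ =
      q ⟨e, (mem_rightIdeal_iff he).2 he.eq⟩ := by
  rw [← map_smul]
  congr 1
  exact Subtype.ext he.eq

theorem exists_correspondsTo_of_hom (he : IsIdempotentElem e)
    (hip : ∑ j, p j ∘ₗ i j = LinearMap.id)
    (hsymm : ∀ x y, e * x = x → x * e = x → e * y = y → y * e = y → l (x * y) = l (y * x))
    (f : I →ₗ[Aᵐᵒᵖ] A) : ∃ h : I →ₗ[K] K, CorrespondsTo e l f h := by
  let e' : rightIdeal e := ⟨e, (mem_rightIdeal_iff he).2 he.eq⟩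
  refine ⟨∑ j, l ∘ₗ LinearMap.mulRight K (f (p j e')) ∘ₗ
    ((rightIdeal e).subtype.restrictScalars K) ∘ₗ (i j).restrictScalars K, fun v z hv hz => ?_⟩
  have h1 : ∀ j, l ((i j (MulOpposite.op z • v) : A) * f (p j e')) =
      l (z * f (p j (i j v))) := by
    intro j
    have hx : (i j v : A) * e = i j v := by rw [← coe_map_op_smul_eq_mul, hv]
    have hy : f (p j e') * e = f (p j e') := by
      rw [← map_op_smul_eq_mul, op_smul_map_generator he]
    rw [coe_map_op_smul_eq_mul, mul_assoc, hsymm _ _ ((mem_rightIdeal_iff he).1 (i j v).2) hx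
      (by rw [← mul_assoc, hz]) (by rw [mul_assoc, hy]), mul_assoc, ← map_op_smul_eq_mul,
      ← map_smul, op_smul_generator he]
  simp only [LinearMap.sum_apply, LinearMap.comp_apply, LinearMap.mulRight_apply]
  refine (Finset.sum_congr rfl fun j _ => h1 j).trans ?_
  rw [← map_sum, ← Finset.mul_sum, ← map_sum]
  have h2 := LinearMap.congr_fun hip v
  simp only [LinearMap.sum_apply, LinearMap.comp_apply, LinearMap.id_apply] at h2
  rw [h2]

theorem exists_correspondsTo_of_form (he : IsIdempotentElem e)
    (hip : ∑ j, p j ∘ₗ i j = LinearMap.id)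
    (hsymm : ∀ x y, e * x = x → x * e = x → e * y = y → y * e = y → l (x * y) = l (y * x))
    (hrep : ∀ g : rightIdeal e →ₗ[K] K, ∃ y, y * e = y ∧ ∀ z : rightIdeal e, g z = l (z * y))
    (h : I →ₗ[K] K) : ∃ f : I →ₗ[Aᵐᵒᵖ] A, CorrespondsTo e l f h := by
  choose y hy hy' using fun j => hrep (h ∘ₗ (p j).restrictScalars K)
  refine ⟨{ toFun := fun x => ∑ j, y j * i j x
            map_add' := fun x x' => by
              rw [← Finset.sum_add_distrib]
              exact Finset.sum_congr rfl fun j _ => by rw [map_add, Submodule.coe_add, mul_add]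
            map_smul' := fun a x => by
              rw [Finset.smul_sum]
              refine Finset.sum_congr rfl fun j _ => ?_
              rw [map_smul]
              exact (mul_assoc (y j) (i j x : A) a.unop).symm }, fun v z hv hz => ?_⟩
  have h2 := LinearMap.congr_fun hip (MulOpposite.op z • v)
  simp only [LinearMap.sum_apply, LinearMap.comp_apply, LinearMap.id_apply] at h2
  rw [← h2, map_sum]
  change _ = l (z * ∑ j, y j * i j v)
  rw [Finset.mul_sum, map_sum]
  refine Finset.sum_congr rfl fun j _ => ?_
  have hx : (i j v : A) * e = i j v := by rw [← coe_map_op_smul_eq_mul, hv]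
  refine (hy' j _).trans ?_
  rw [coe_map_op_smul_eq_mul, mul_assoc, hsymm _ _ ((mem_rightIdeal_iff he).1 (i j v).2) hx
      (by rw [← mul_assoc, hz]) (by rw [mul_assoc, hy]), mul_assoc]

end Correspondence

/-- The functor `Hom(-, A)` is exact on `add (eA)`, being isomorphic there to the duality `D`. -/
theorem DualBimoduleIso.exists_extension [Module.Finite K A] {e : A} (he : IsIdempotentElem e)
    (h : DualBimoduleIso K e) {I₁ I₂ I₃ : ModuleCat.{u} Aᵐᵒᵖ}
    (hI₁ : InAdd (ModuleCat.of Aᵐᵒᵖ (rightIdeal e)) I₁)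
    (hI₂ : InAdd (ModuleCat.of Aᵐᵒᵖ (rightIdeal e)) I₂)
    (hI₃ : InAdd (ModuleCat.of Aᵐᵒᵖ (rightIdeal e)) I₃)
    (d₁ : I₁ →ₗ[Aᵐᵒᵖ] I₂) (d₂ : I₂ →ₗ[Aᵐᵒᵖ] I₃) (hd : Function.Exact d₁ d₂)
    (f : I₂ →ₗ[Aᵐᵒᵖ] A) (hf : f ∘ₗ d₁ = 0) : ∃ g : I₃ →ₗ[Aᵐᵒᵖ] A, g ∘ₗ d₂ = f := by
  obtain ⟨l, hsymm, hnd, hrep⟩ := h.exists_form he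
  obtain ⟨n₁, i₁, p₁, hip₁⟩ := inAdd_iff.1 hI₁
  obtain ⟨n₂, i₂, p₂, hip₂⟩ := inAdd_iff.1 hI₂
  obtain ⟨n₃, i₃, p₃, hip₃⟩ := inAdd_iff.1 hI₃
  let _ := vectorSpaceOfModule K (R := Aᵐᵒᵖ) I₁
  have := isScalarTower_vectorSpaceOfModule (K := K) (R := Aᵐᵒᵖ) I₁
  let _ := vectorSpaceOfModule K (R := Aᵐᵒᵖ) I₂
  have := isScalarTower_vectorSpaceOfModule (K := K) (R := Aᵐᵒᵖ) I₂
  let _ := vectorSpaceOfModule K (R := Aᵐᵒᵖ) I₃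
  have := isScalarTower_vectorSpaceOfModule (K := K) (R := Aᵐᵒᵖ) I₃
  obtain ⟨η, hη⟩ := exists_correspondsTo_of_hom he hip₂ hsymm f
  -- the linear form corresponding to `f` vanishes on the image of `d₁`
  have hη₁ : ∀ x, η (d₁ x) = 0 := by
    intro x
    rw [eq_sum_op_smul he hip₁ x, map_sum, map_sum]
    refine Finset.sum_eq_zero fun j _ => ?_
    rw [map_smul, hη _ _ (by rw [← map_smul, op_smul_map_generator he])
      ((mem_rightIdeal_iff he).1 (i₁ j x).2)]
    have : f (d₁ (p₁ j ⟨e, (mem_rightIdeal_iff he).2 he.eq⟩)) = 0 := LinearMap.congr_fun hf _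
    rw [this, mul_zero, map_zero]
  -- hence it extends along `d₂`
  obtain ⟨θ, hθ⟩ : ∃ θ : I₃ →ₗ[K] K, θ ∘ₗ d₂.restrictScalars K = η := by
    have hle : LinearMap.ker (d₂.restrictScalars K) ≤ LinearMap.ker η := by
      intro x hx
      obtain ⟨y, rfl⟩ := (hd x).1 hx
      exact hη₁ y
    exact (LinearMap.range_dualMap_eq_dualAnnihilator_ker (d₂.restrictScalars K)).ge
      ((Submodule.mem_dualAnnihilator _).2 fun x hx => hle hx)
  obtain ⟨g, hg⟩ := exists_correspondsTo_of_form he hip₃ hsymm hrep θ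
  refine ⟨g, ?_⟩
  have key : ∀ v : I₂, MulOpposite.op e • v = v → g (d₂ v) = f v := by
    intro v hv
    rw [← sub_eq_zero]
    refine hnd _ ?_ fun z hz => ?_
    · rw [sub_mul, ← map_op_smul_eq_mul, ← map_op_smul_eq_mul, ← map_smul, hv]
    · rw [mul_sub, map_sub, ← hη v z hv hz, ← hg (d₂ v) z (by rw [← map_smul, hv]) hz, ← hθ,
        ← map_smul]
      exact sub_self _
  ext x
  rw [eq_sum_op_smul he hip₂ x, map_sum, map_sum]
  refine Finset.sum_congr rfl fun j _ => ?_
  rw [map_smul, map_smul, LinearMap.comp_apply, key _ (op_smul_map_generator he _)]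

end Duality

/-! ### Projective-injective modules -/

section ProjectiveInjective

variable {K R : Type u} [Field K] [Ring R] [Algebra K R]

variable (K) in
theorem exists_injective_regular_to_pi (W : Type u) [AddCommGroup W] [Module R W]
    [Module.Finite K R] [Module.Finite R W] [FaithfulSMul R W] :
    ∃ (n : ℕ) (f : R →ₗ[R] (Fin n → W)), Function.Injective f := by
  let _ := vectorSpaceOfModule K (R := R) W
  have := isScalarTower_vectorSpaceOfModule (K := K) (R := R) W
  have : Module.Finite K W := Module.Finite.trans R W
  obtain ⟨n, w, hw⟩ := Module.Finite.exists_fin (R := K) (M := W)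
  refine ⟨n, LinearMap.pi fun j => LinearMap.toSpanSingleton R W (w j), ?_⟩
  rw [← LinearMap.ker_eq_bot, eq_bot_iff]
  intro r hr
  have hr' : ∀ j, r • w j = 0 := fun j => congrFun hr j
  rw [Submodule.mem_bot]
  refine FaithfulSMul.eq_of_smul_eq_smul (α := W) fun x => ?_
  rw [zero_smul]
  have hx : x ∈ Submodule.span K (Set.range w) := hw ▸ Submodule.mem_top
  induction hx using Submodule.span_induction with
  | mem x hx =>
    obtain ⟨j, rfl⟩ := hx
    exact hr' j
  | zero => exact smul_zero r
  | add x y _ _ hx hy => rw [smul_add, hx, hy, add_zero]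
  | smul a x _ hx => rw [smul_comm, hx, smul_zero]

/-- A projective module with a finitely generated essential submodule embeds into a finitely
generated free module. -/
theorem exists_injective_to_free {E : Type u} [AddCommGroup E] [Module R E]
    [Module.Projective R E] (N : Submodule R E) (hN : N.FG)
    (hess : ∀ L : Submodule R E, L ⊓ N = ⊥ → L = ⊥) :
    ∃ (ι : Type u) (_ : Fintype ι) (f : E →ₗ[R] (ι → R)), Function.Injective f := by
  classical
  obtain ⟨s, hs⟩ := Module.projective_def'.1 (inferInstance : Module.Projective R E)
  have hsinj : Function.Injective s := Function.LeftInverse.injective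
    (g := Finsupp.linearCombination R id) (fun x => LinearMap.congr_fun hs x)
  obtain ⟨G, rfl⟩ := hN
  -- the coordinates that occur in the generators
  let F : Finset E := G.biUnion fun x => (s x).support
  let f : E →ₗ[R] (F → R) := LinearMap.pi fun j => Finsupp.lapply (j : E) ∘ₗ s
  refine ⟨F, inferInstance, f, ?_⟩
  rw [← LinearMap.ker_eq_bot]
  refine hess _ ?_
  rw [eq_bot_iff]
  rintro x ⟨hx, hxN⟩
  have hsupp : s x ∈ Finsupp.supported R R (F : Set E) := by
    have hle : Submodule.span R (G : Set E) ≤ (Finsupp.supported R R (F : Set E)).comap s := by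
      rw [Submodule.span_le]
      intro y hy
      rw [SetLike.mem_coe, Submodule.mem_comap, Finsupp.mem_supported]
      intro a ha
      exact Finset.mem_biUnion.2 ⟨y, hy, ha⟩
    exact hle hxN
  rw [Submodule.mem_bot]
  apply hsinj
  rw [map_zero]
  ext a
  by_cases ha : a ∈ F
  · exact congrFun hx ⟨a, ha⟩
  · rw [Finsupp.mem_supported] at hsupp
    by_contra h0
    exact ha (hsupp (Finsupp.mem_support_iff.2 h0))

variable (K) in
/-- A projective-injective module with a finitely generated essential submodule lies in `add W`
for every faithful module `W`. -/
theorem inAdd_of_projective_injective [Module.Finite K R] {W E : ModuleCat.{u} R}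
    [Module.Finite R W] [FaithfulSMul R W] [Module.Projective R E] [Module.Injective R E]
    (N : Submodule R E) (hN : N.FG) (hess : ∀ L : Submodule R E, L ⊓ N = ⊥ → L = ⊥) :
    InAdd W E := by
  obtain ⟨ι, _, f, hf⟩ := exists_injective_to_free N hN hess
  obtain ⟨n, g, hg⟩ := exists_injective_regular_to_pi K (R := R) W
  let k : E →ₗ[R] (ι × Fin n → W) := LinearMap.pi fun a => LinearMap.proj a.2 ∘ₗ g ∘ₗ
    LinearMap.proj a.1 ∘ₗ f
  have hk : Function.Injective k := by
    intro x y hxy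
    apply hf
    ext a
    apply hg
    ext b
    exact congrFun hxy (a, b)
  let c := Fintype.equivFin (ι × Fin n)
  let k' : E →ₗ[R] (Fin (Fintype.card (ι × Fin n)) → W) :=
    (LinearEquiv.funCongrLeft R W c.symm).toLinearMap ∘ₗ k
  obtain ⟨r, hr⟩ := Module.Injective.out k'
    ((LinearEquiv.funCongrLeft R W c.symm).injective.comp hk) (LinearMap.id : E →ₗ[R] E)
  exact ⟨_, k', r, LinearMap.ext hr⟩

end ProjectiveInjective

/-! ### Cosyzygies -/

section Cosyzygies

variable {R : Type u} [Ring R]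

/-- An injective resolution `0 → M → E 0 → E 1 → ⋯` cut into short exact sequences
`0 → Z i → E i → Z (i + 1) → 0` with `M ≅ Z 0`; thus `Z i` is an `i`-th cosyzygy of `M`. -/
structure CosyzygySequence (M : ModuleCat.{u} R) where
  E : ℕ → ModuleCat.{u} R
  Z : ℕ → ModuleCat.{u} R
  f : ∀ i, Z i →ₗ[R] E i
  g : ∀ i, E i →ₗ[R] Z (i + 1)
  inj : ∀ i, Function.Injective (f i)
  surj : ∀ i, Function.Surjective (g i)
  exact : ∀ i, Function.Exact (f i) (g i)
  injective : ∀ i, Module.Injective R (E i)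
  equiv : M ≃ₗ[R] Z 0

/-- The cosyzygies of an injective resolution, as the kernels of its differentials. -/
noncomputable def CosyzygySequence.ofResolution {M : ModuleCat.{u} R} (I : InjectiveResolution M) :
    CosyzygySequence M where
  E := I.cocomplex.X
  Z i := ModuleCat.of R (LinearMap.ker (I.cocomplex.d i (i + 1)).hom)
  f i := (LinearMap.ker (I.cocomplex.d i (i + 1)).hom).subtype
  g i := (I.cocomplex.d i (i + 1)).hom.codRestrict _ (fun x =>
    LinearMap.congr_fun (congrArg ModuleCat.Hom.hom (I.cocomplex.d_comp_d i (i + 1) (i + 2))) x)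
  inj i := Submodule.subtype_injective _
  surj i := by
    rintro ⟨y, hy⟩
    obtain ⟨x, hx⟩ := ((ShortComplex.moduleCat_exact_iff _).1 (I.exact_succ i)) y hy
    exact ⟨x, Subtype.ext hx⟩
  exact i := by
    intro x
    constructor
    · intro hx
      exact ⟨⟨x, congrArg Subtype.val hx⟩, rfl⟩
    · rintro ⟨x, rfl⟩
      exact Subtype.ext x.2
  injective i := (Module.injective_iff_injective_object R _).2 (I.injective i)
  equiv := (Limits.IsLimit.conePointUniqueUpToIso I.isLimitKernelFork
    (ModuleCat.kernelIsLimit (I.cocomplex.d 0 1))).toLinearEquiv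

namespace CosyzygySequence

variable {M : ModuleCat.{u} R} (c : CosyzygySequence M)

theorem g_f (i : ℕ) (x : c.Z i) : c.g i (c.f i x) = 0 := (c.exact i (c.f i x)).2 ⟨x, rfl⟩

/-- The short exact sequence `0 → Z i → E i → Z (i + 1) → 0`. -/
def shortComplex (i : ℕ) : ShortComplex (ModuleCat.{u} R) :=
  ShortComplex.mk (ModuleCat.ofHom (c.f i)) (ModuleCat.ofHom (c.g i))
    (ModuleCat.hom_ext (LinearMap.ext (c.g_f i)))

theorem shortExact (i : ℕ) : (c.shortComplex i).ShortExact :=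
  ModuleCat.shortComplex_shortExact _ (c.exact i) (c.inj i) (c.surj i)

theorem injective_X₂ (i : ℕ) : Injective (c.shortComplex i).X₂ :=
  (Module.injective_iff_injective_object R (c.E i)).1 (c.injective i)

/-- The differential `E i → E (i + 1)`. -/
def d (i : ℕ) : c.E i →ₗ[R] c.E (i + 1) := c.f (i + 1) ∘ₗ c.g i

theorem exact_d (i : ℕ) : Function.Exact (c.d i) (c.d (i + 1)) := by
  intro x
  constructor
  · intro hx
    have h0 : c.g (i + 1) x = 0 := by
      apply c.inj
      rw [map_zero]
      exact hx
    obtain ⟨z, rfl⟩ := (c.exact (i + 1) x).1 h0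
    obtain ⟨y, rfl⟩ := c.surj i z
    exact ⟨y, rfl⟩
  · rintro ⟨y, rfl⟩
    change c.f (i + 2) (c.g (i + 1) (c.f (i + 1) (c.g i y))) = 0
    rw [c.g_f, map_zero]

/-- Dimension shifting along the first `n` terms, when these are projective. -/
theorem ext_succ_succ_iff {i m : ℕ} (hi : Module.Projective R (c.E i)) (hm : 1 ≤ m)
    (Y : ModuleCat.{u} R) : Subsingleton (Abelian.Ext (c.Z (i + 1)) Y (m + 1)) ↔
      Subsingleton (Abelian.Ext (c.Z i) Y m) := by
  have : Projective (c.shortComplex i).X₂ := (IsProjective.iff_projective (c.E i)).1 hi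
  exact ext_subsingleton_succ_iff_left (c.shortExact i) Y hm

theorem ext_iff_ext_zero (X : ModuleCat.{u} R) (j : ℕ) {m : ℕ} (hm : 1 ≤ m) :
    Subsingleton (Abelian.Ext X (c.Z j) m) ↔ Subsingleton (Abelian.Ext X (c.Z 0) (m + j)) := by
  induction j generalizing m with
  | zero => rfl
  | succ j ih =>
    have := c.injective_X₂ j
    have h := ext_subsingleton_succ_iff_right (c.shortExact j) X hm
    have h' := ih (m := m + 1) (by omega)
    rw [show m + (j + 1) = m + 1 + j by omega, ← h']
    exact h.symm

theorem ext_add_iff {n : ℕ} (hproj : ∀ i < n, Module.Projective R (c.E i))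
    (Y : ModuleCat.{u} R) (a : ℕ) {i m : ℕ} (hm : 1 ≤ m) (hi : i + a ≤ n) :
    Subsingleton (Abelian.Ext (c.Z (i + a)) Y (m + a)) ↔
      Subsingleton (Abelian.Ext (c.Z i) Y m) := by
  induction a with
  | zero => rfl
  | succ a ih =>
    rw [← ih (by omega)]
    exact c.ext_succ_succ_iff (i := i + a) (m := m + a) (hproj _ (by omega)) (by omega) Y

/-- `Ext¹(Z (s + 3), M) = 0` when `Hom(-, M)` is exact on the terms of the resolution involved. -/
theorem ext_one_eq_zero {s : ℕ} (hs : Module.Projective R (c.E (s + 2)))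
    (hdual : ∀ f : c.E (s + 1) →ₗ[R] c.Z 0, f ∘ₗ c.d s = 0 →
      ∃ g : c.E (s + 2) →ₗ[R] c.Z 0, g ∘ₗ c.d (s + 1) = f) :
    Subsingleton (Abelian.Ext (c.Z (s + 3)) (c.Z 0) 1) := by
  have : Projective (c.shortComplex (s + 2)).X₂ := (IsProjective.iff_projective (c.E (s + 2))).1 hs
  refine ext_one_subsingleton_of_extension (c.shortExact (s + 2)) fun φ => ?_
  let φ' : c.Z (s + 2) →ₗ[R] c.Z 0 := φ.hom
  obtain ⟨g, hg⟩ := hdual (φ' ∘ₗ c.g (s + 1)) (by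
    ext x
    change φ' (c.g (s + 1) (c.f (s + 1) (c.g s x))) = 0
    rw [c.g_f, map_zero])
  refine ⟨ModuleCat.ofHom g, ModuleCat.hom_ext (LinearMap.ext fun x => ?_)⟩
  obtain ⟨y, rfl⟩ := c.surj (s + 1) x
  exact LinearMap.congr_fun hg y

/-- `Ext¹(Z 1, M) ≠ 0` if `M` is not injective. -/
theorem not_subsingleton_ext_one (hM : ¬ Module.Injective R M) :
    ¬ Subsingleton (Abelian.Ext (c.Z 1) (c.Z 0) 1) := by
  intro h
  apply hM
  obtain ⟨r, hr⟩ := @exists_extension_of_ext_one _ _ _ _ _ (c.shortExact 0) (c.Z 0) h (𝟙 (c.Z 0))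
  have hr' : ∀ x, r.hom (c.f 0 x) = x := fun x =>
    LinearMap.congr_fun (congrArg ModuleCat.Hom.hom hr) x
  refine ⟨fun X Y _ _ _ _ i hi k => ?_⟩
  obtain ⟨k', hk'⟩ := (c.injective 0).out i hi (c.f 0 ∘ₗ c.equiv.toLinearMap ∘ₗ k)
  refine ⟨c.equiv.symm.toLinearMap ∘ₗ r.hom ∘ₗ k', fun x => ?_⟩
  change c.equiv.symm (r.hom (k' (i x))) = k x
  rw [hk']
  change c.equiv.symm (r.hom (c.f 0 (c.equiv (k x)))) = k x
  rw [hr', LinearEquiv.symm_apply_apply]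

end CosyzygySequence

end Cosyzygies

/-! ### Large rigid modules -/

section LowerBound

variable {R : Type u} [Ring R]

theorem isRigid_pi {k n : ℕ} (F : Fin n → ModuleCat.{u} R)
    (h : ∀ a b, ExtVanishes k (F a) (F b)) : IsRigid k (ModuleCat.of R (∀ a, F a)) := by
  intro X Y hX hY m hm hm'
  obtain ⟨_, i, p, hip⟩ := inAdd_iff.1 hX
  obtain ⟨_, i', p', hip'⟩ := inAdd_iff.1 hY
  have hsum : ∑ a, LinearMap.single R (fun a => F a) a ∘ₗ LinearMap.proj a = LinearMap.id := by
    refine LinearMap.ext fun x => ?_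
    rw [LinearMap.sum_apply]
    exact LinearMap.sum_single_apply _ _
  have hsum' := sum_ofHom_comp (X := ModuleCat.of R (∀ a, F a)) (F := F) _ _ hsum
  refine ext_subsingleton_of_sum_left _ _ (sum_ofHom_comp i p hip) m fun _ => ?_
  refine ext_subsingleton_of_sum_right _ _ (sum_ofHom_comp i' p' hip') m fun _ => ?_
  refine ext_subsingleton_of_sum_left _ _ hsum' m fun a => ?_
  exact ext_subsingleton_of_sum_right _ _ hsum' m fun b => h a b m hm hm'

theorem IsDirectSummand.trans {X Y Z : ModuleCat.{u} R} (h : IsDirectSummand X Y)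
    (h' : IsDirectSummand Y Z) : IsDirectSummand X Z := by
  obtain ⟨i, p, hip⟩ := h
  obtain ⟨i', p', hip'⟩ := h'
  refine ⟨i' ∘ₗ i, p ∘ₗ p', LinearMap.ext fun x => ?_⟩
  have h1 : p' (i' (i x)) = i x := LinearMap.congr_fun hip' _
  simp only [LinearMap.comp_apply, h1]
  exact LinearMap.congr_fun hip x

theorem isDirectSummand_pi {n : ℕ} (F : Fin n → ModuleCat.{u} R) (a : Fin n) :
    IsDirectSummand (F a) (ModuleCat.of R (∀ a, F a)) :=
  ⟨LinearMap.single R (fun a => F a) a, LinearMap.proj a, LinearMap.ext fun x => by simp⟩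

theorem IsDirectSummand.of_linearEquiv {X Y : ModuleCat.{u} R} (e : X ≃ₗ[R] Y) :
    IsDirectSummand X Y :=
  ⟨e.toLinearMap, e.symm.toLinearMap, LinearMap.ext fun x => by simp⟩

theorem IsDirectSummand.ext_subsingleton {X Y Z : ModuleCat.{u} R} (h : IsDirectSummand X Y)
    {n : ℕ} (hY : Subsingleton (Abelian.Ext Y Z n)) : Subsingleton (Abelian.Ext X Z n) := by
  obtain ⟨i, p, hip⟩ := h
  exact ext_subsingleton_of_sum_left _ _ (sum_ofHom_comp (ι := Fin 1) (F := fun _ => Y)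
    (fun _ => i) (fun _ => p) (by simpa using hip)) n fun _ => hY

theorem exists_indecomposable_summand_ext {X Y : ModuleCat.{u} R} [IsArtinian R X]
    [IsNoetherian R X] {n : ℕ} (h : ¬ Subsingleton (Abelian.Ext X Y n)) :
    ∃ U : ModuleCat.{u} R, Indecomposable U ∧ IsDirectSummand U X ∧
      ¬ Subsingleton (Abelian.Ext U Y n) := by
  obtain ⟨m, U, i, p, hU, hip, hsum⟩ := exists_indecomposable_decomposition X
  by_contra hcon
  push Not at hcon
  exact h (ext_subsingleton_of_sum_left _ _ (sum_ofHom_comp i p hsum) n fun j =>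
    not_not.1 fun h' => h' (hcon (U j) (hU j).indecomposable ⟨p j, i j, hip j⟩))

/-- The regular module has at least as many indecomposable summands as there are simple modules. -/
theorem exists_projective_family_of_le [IsArtinian R R] [IsNoetherian R R] {w : ℕ}
    (hw : (w : ℕ∞) ≤ numSimpleModules R) : ∃ P : Fin w → ModuleCat.{u} R,
      (∀ a, Indecomposable (P a) ∧ IsDirectSummand (P a) (ModuleCat.of R R)) ∧
        ∀ a b, Nonempty (P a ≃ₗ[R] P b) → a = b := by
  obtain ⟨S, hS, hinj⟩ := exists_family_of_le_numIsoClasses hw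
  obtain ⟨n, Y, hY, hsum, h1, h2⟩ := exists_projective_family R
  choose j f hf using fun a => h1 (S a) (hS a)
  refine ⟨fun a => Y (j a), fun a => ⟨(hY _).indecomposable, hsum _⟩, fun a b hab => ?_⟩
  obtain ⟨e⟩ := hab
  refine hinj a b (h2 (S a) (S b) (hS a) (hS b) (j a) (f a) (f b ∘ₗ e.toLinearMap) (hf a) ?_)
  intro h0
  apply hf b
  ext x
  simpa using LinearMap.congr_fun h0 (e.symm x)

theorem numSimpleModules_le_of_family {κ : Type} [Fintype κ] {S : κ → ModuleCat.{u} R}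
    (hS : ∀ T : ModuleCat.{u} R, IsSimpleModule R T → ∃ a, Nonempty (T ≃ₗ[R] S a)) :
    numSimpleModules R ≤ Fintype.card κ := by
  by_contra hlt
  obtain ⟨F, hF, hinj⟩ := exists_family_of_le_numIsoClasses (n := Fintype.card κ + 1)
    (S := {X : ModuleCat.{u} R | IsSimpleModule R X}) (by
      rw [Nat.cast_add, Nat.cast_one]
      exact Order.add_one_le_of_lt (not_le.1 hlt))
  choose a ha using fun i => hS (F i) (hF i)
  obtain ⟨i, j, hij, h⟩ := Fintype.exists_ne_map_eq_of_card_lt a (by simp)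
  obtain ⟨e⟩ := ha i
  obtain ⟨e'⟩ := ha j
  rw [← h] at e'
  exact hij (hinj i j ⟨e.trans e'.symm⟩)

/-- If the first `n` terms of an injective resolution of the regular module are projective and
`Ext¹(Z s, Z 0)` vanishes for `3 ≤ s ≤ n`, then every `(k + 2)`-nd cosyzygy up to `n` contributes a
new indecomposable module to a `k`-rigid module containing the projective modules. -/
theorem CosyzygySequence.le_rigidSize [IsArtinianRing R] [IsNoetherianRing R]
    {M : ModuleCat.{u} R} (c : CosyzygySequence M) (e : R ≃ₗ[R] M) (hM : ¬ Module.Injective R M)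
    {n : ℕ} (hproj : ∀ i < n, Module.Projective R (c.E i))
    (hfin : ∀ i ≤ n, Module.Finite R (c.Z i))
    (hext : ∀ s, s + 3 ≤ n → Subsingleton (Abelian.Ext (c.Z (s + 3)) (c.Z 0) 1))
    {k t w : ℕ} (ht : (k + 2) * t ≤ n) (hw : (w : ℕ∞) ≤ numSimpleModules R) :
    ((w + t : ℕ) : ℕ∞) ≤ rigidSize R k := by
  have hZ0 : Module.Projective R (c.Z 0) := Module.Projective.of_equiv (e ≪≫ₗ c.equiv)
  have hZ0' : Projective (c.Z 0) := (IsProjective.iff_projective (c.Z 0)).1 hZ0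
  -- vanishing of `Extᵐ(Z i, Z 0)` away from `m = i` and `m = i - 1`
  have hlarge : ∀ i m, i < m → i ≤ n → Subsingleton (Abelian.Ext (c.Z i) (c.Z 0) m) := by
    intro i m him hin
    obtain ⟨b, rfl⟩ : ∃ b, m = b + 1 + i := ⟨m - 1 - i, by omega⟩
    have := c.ext_add_iff hproj (c.Z 0) i (i := 0) (m := b + 1) (by omega) (by omega)
    rw [zero_add] at this
    exact this.2 (subsingleton_of_forall_eq 0 fun x => x.eq_zero_of_projective)
  have hsmall : ∀ i m, 1 ≤ m → m + 2 ≤ i → i ≤ n →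
      Subsingleton (Abelian.Ext (c.Z i) (c.Z 0) m) := by
    intro i m hm him hin
    obtain ⟨a, rfl⟩ : ∃ a, m = 1 + a := ⟨m - 1, by omega⟩
    obtain ⟨s, rfl⟩ : ∃ s, i = s + 3 + a := ⟨i - 3 - a, by omega⟩
    exact (c.ext_add_iff hproj (c.Z 0) a le_rfl hin).2 (hext s (by omega))
  have hdiag : ∀ i, 1 ≤ i → i ≤ n → ¬ Subsingleton (Abelian.Ext (c.Z i) (c.Z 0) i) := by
    intro i hi hin
    obtain ⟨a, rfl⟩ : ∃ a, i = 1 + a := ⟨i - 1, by omega⟩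
    rw [c.ext_add_iff hproj (c.Z 0) a le_rfl hin]
    exact c.not_subsingleton_ext_one hM
  have hle : ∀ q, q ≤ t → (k + 2) * q ≤ n := fun q hq => (Nat.mul_le_mul_left _ hq).trans ht
  have hgap : ∀ {q q' : ℕ}, q < q' → (k + 2) * q + (k + 2) ≤ (k + 2) * q' := by
    intro q q' h
    have := Nat.mul_le_mul_left (k + 2) h
    rw [Nat.succ_eq_add_one, mul_add, mul_one] at this
    exact this
  let F : Fin (t + 1) → ModuleCat.{u} R := fun q => c.Z ((k + 2) * q)
  have hF : ∀ q : Fin (t + 1), (k + 2) * (q : ℕ) ≤ n := fun q => hle _ (by omega)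
  have hFfin : ∀ q, Module.Finite R (F q) := fun q => hfin _ (hF q)
  have hrigid : IsRigid k (ModuleCat.of R (∀ q, F q)) := by
    refine isRigid_pi F fun a b m hm hm' => ?_
    change Subsingleton (Abelian.Ext (c.Z ((k + 2) * a)) (c.Z ((k + 2) * b)) m)
    rw [c.ext_iff_ext_zero _ _ hm]
    rcases le_or_gt (a : ℕ) b with hab | hab
    · have := Nat.mul_le_mul_left (k + 2) hab
      exact hlarge _ _ (by omega) (hF a)
    · have := hgap hab
      exact hsmall _ _ (by omega) (by omega) (hF a)
  obtain ⟨P, hP, hPinj⟩ := exists_projective_family_of_le hw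
  have hPext : ∀ a m, 1 ≤ m → Subsingleton (Abelian.Ext (P a) (c.Z 0) m) := by
    intro a m hm
    obtain ⟨m, rfl⟩ := Nat.exists_eq_add_of_le' hm
    have : Projective (ModuleCat.of R R) :=
      (IsProjective.iff_projective R).1 (inferInstanceAs (Module.Projective R R))
    exact (hP a).2.ext_subsingleton (subsingleton_of_forall_eq 0 fun x => x.eq_zero_of_projective)
  have hU : ∀ q : Fin t, ∃ U : ModuleCat.{u} R, Indecomposable U ∧
      IsDirectSummand U (F q.succ) ∧
        ¬ Subsingleton (Abelian.Ext U (c.Z 0) ((k + 2) * (q + 1))) := by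
    intro q
    have : Module.Finite R (F q.succ) := hFfin _
    have : IsArtinian R (F q.succ) := inferInstance
    refine exists_indecomposable_summand_ext (X := F q.succ) ?_
    exact hdiag _ (Nat.mul_pos (by omega) (Nat.succ_pos _)) (hle _ q.2)
  choose U hUi hUs hUe using hU
  have hUext : ∀ q q' : Fin t, Nonempty (U q ≃ₗ[R] U q') → q = q' := by
    rintro q q' ⟨f⟩
    by_contra hne
    apply hUe q
    have hs : IsDirectSummand (U q) (F q'.succ) :=
      (IsDirectSummand.of_linearEquiv f).trans (hUs q')
    refine hs.ext_subsingleton ?_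
    have h0 := hgap (Nat.succ_pos (q : ℕ))
    rw [Nat.succ_eq_add_one] at h0
    change Subsingleton (Abelian.Ext (c.Z ((k + 2) * (q' + 1))) (c.Z 0) ((k + 2) * (q + 1)))
    rcases lt_or_gt_of_ne (fun h => hne (Fin.ext h) : (q : ℕ) ≠ q') with h | h
    · have := hgap (Nat.succ_lt_succ h)
      simp only [Nat.succ_eq_add_one] at this
      exact hsmall _ _ (by omega) (by omega) (hle _ q'.2)
    · have := hgap (Nat.succ_lt_succ h)
      simp only [Nat.succ_eq_add_one] at this
      exact hlarge _ _ (by omega) (hle _ q'.2)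
  have hPU : ∀ a q, ¬ Nonempty (P a ≃ₗ[R] U q) := by
    rintro a q ⟨f⟩
    exact hUe q ((IsDirectSummand.of_linearEquiv f.symm).ext_subsingleton
      (hPext a _ (Nat.mul_pos (by omega) (Nat.succ_pos _))))
  have hsize : ((w + t : ℕ) : ℕ∞) ≤ moduleSize (ModuleCat.of R (∀ q, F q)) := by
    have hcard : Fintype.card (Fin w ⊕ Fin t) = w + t := by simp
    rw [← hcard]
    refine le_numIsoClasses_of_family (Sum.elim P U) ?_ ?_
    · rintro (a | q)
      · refine ⟨(hP a).1, (hP a).2.trans ?_⟩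
        have h1 : IsDirectSummand (ModuleCat.of R R) (F 0) :=
          IsDirectSummand.of_linearEquiv (X := ModuleCat.of R R) (Y := c.Z 0) (e ≪≫ₗ c.equiv)
        exact h1.trans (isDirectSummand_pi F 0)
      · exact ⟨hUi q, (hUs q).trans (isDirectSummand_pi F q.succ)⟩
    · rintro (a | q) (b | q') h
      · exact congrArg Sum.inl (hPinj a b h)
      · exact absurd h (hPU a q')
      · exact absurd (h.map LinearEquiv.symm) (hPU b q)
      · exact congrArg Sum.inr (hUext q q' h)
  refine hsize.trans ?_
  refine le_iSup_of_le (ModuleCat.of R (∀ q, F q)) (le_iSup_of_le ?_ (le_iSup_of_le hrigid le_rfl))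
  exact inferInstanceAs (Module.Finite R (∀ q, F q))

end LowerBound

/-! ### Dominant dimension of gendo-symmetric algebras -/

section DominantDimension

/-- The right regular module is the regular module of the opposite ring. -/
def opRegularEquiv (A : Type u) [Ring A] : Aᵐᵒᵖ ≃ₗ[Aᵐᵒᵖ] A where
  toFun := MulOpposite.unop
  invFun := MulOpposite.op
  map_add' _ _ := rfl
  map_smul' _ _ := rfl
  left_inv _ := rfl
  right_inv _ := rfl

/-- A minimal injective resolution of `A` whose first `n` terms are projective gives rise to a
`k`-rigid module with at least `n / (k + 2)` more indecomposable summands than there are simple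
modules. -/
theorem le_rigidSize_of_minimal_resolution {K A : Type u} [Field K] [Ring A] [Algebra K A]
    [Module.Finite K A] {e : A} (he : IsIdempotentElem e)
    (hfaith : FaithfulSMul Aᵐᵒᵖ (rightIdeal e)) (hdual : DualBimoduleIso K e)
    (hns : ¬ IsSelfinjective A) {n : ℕ} (I : InjectiveResolution (ModuleCat.of Aᵐᵒᵖ A))
    (hmin : IsMinimalResolution I)
    (hproj : ∀ i < n, Module.Projective Aᵐᵒᵖ (I.cocomplex.X i)) {k t w : ℕ}
    (ht : (k + 2) * t ≤ n) (hw : (w : ℕ∞) ≤ numSimpleModules Aᵐᵒᵖ) :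
    ((w + t : ℕ) : ℕ∞) ≤ rigidSize Aᵐᵒᵖ k := by
  have : Module.Finite K Aᵐᵒᵖ := Module.Finite.equiv (MulOpposite.opLinearEquiv K)
  have hRA : IsArtinianRing Aᵐᵒᵖ := isArtinian_of_tower K (inferInstance : IsArtinian K Aᵐᵒᵖ)
  have hRN : IsNoetherianRing Aᵐᵒᵖ := isNoetherian_of_tower K (inferInstance : IsNoetherian K Aᵐᵒᵖ)
  let W : ModuleCat.{u} Aᵐᵒᵖ := ModuleCat.of Aᵐᵒᵖ (rightIdeal e)
  have hWfin : Module.Finite Aᵐᵒᵖ W := inferInstanceAs (Module.Finite Aᵐᵒᵖ (rightIdeal e))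
  have hWfaith : FaithfulSMul Aᵐᵒᵖ W := hfaith
  let c := CosyzygySequence.ofResolution I
  have hadd : ∀ i < n, Module.Finite Aᵐᵒᵖ (c.Z i) → InAdd W (c.E i) := by
    intro i hi hfin
    have h1 : Module.Projective Aᵐᵒᵖ (c.E i) := hproj i hi
    have h2 : Module.Injective Aᵐᵒᵖ (c.E i) := c.injective i
    refine inAdd_of_projective_injective K (LinearMap.range (c.f i)) ?_ fun L hL => ?_
    · rw [LinearMap.range_eq_map]
      exact hfin.fg_top.map _
    · have hr : LinearMap.range (c.f i) = LinearMap.ker (I.cocomplex.d i (i + 1)).hom :=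
        Submodule.range_subtype _
      exact hmin i L (hr ▸ hL)
  have hfin : ∀ i ≤ n, Module.Finite Aᵐᵒᵖ (c.Z i) := by
    intro i
    induction i with
    | zero => exact fun _ => Module.Finite.equiv (opRegularEquiv A ≪≫ₗ c.equiv)
    | succ i ih =>
      intro hi
      obtain ⟨m, j, p, hjp⟩ := hadd i (by omega) (ih (by omega))
      have : Module.Finite Aᵐᵒᵖ (c.E i) := by
        have : Module.Finite Aᵐᵒᵖ (Fin m → W) := inferInstance
        exact Module.Finite.of_surjective p fun x => ⟨j x, LinearMap.congr_fun hjp x⟩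
      exact Module.Finite.of_surjective (c.g i) (c.surj i)
  refine c.le_rigidSize (opRegularEquiv A) hns hproj hfin (fun s hs => ?_) ht hw
  refine c.ext_one_eq_zero (hproj _ (by omega)) fun f hf => ?_
  obtain ⟨g, hg⟩ := hdual.exists_extension he (hadd s (by omega) (hfin _ (by omega)))
    (hadd (s + 1) (by omega) (hfin _ (by omega))) (hadd (s + 2) (by omega) (hfin _ (by omega)))
    (c.d s) (c.d (s + 1)) (c.exact_d s) (c.equiv.symm.toLinearMap ∘ₗ f)
    (by rw [LinearMap.comp_assoc, hf, LinearMap.comp_zero])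
  refine ⟨c.equiv.toLinearMap ∘ₗ g, ?_⟩
  rw [LinearMap.comp_assoc, hg]
  exact LinearMap.ext fun x => c.equiv.apply_symm_apply _

theorem exists_of_lt_dominantDim {R : Type u} [Ring R] {M : ModuleCat.{u} R} {m : ℕ}
    (h : (m : ℕ∞) < dominantDim M) : ∃ n, m < n ∧ ∃ I : InjectiveResolution M,
      IsMinimalResolution I ∧ ∀ i < n, Module.Projective R (I.cocomplex.X i) := by
  rw [dominantDim, lt_iSup_iff] at h
  obtain ⟨n, hn⟩ := h
  rw [lt_iSup_iff] at hn
  obtain ⟨hI, hn⟩ := hn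
  exact ⟨n, by exact_mod_cast hn, hI⟩

end DominantDimension

theorem mainTheorem3 (K A : Type u) [Field K] [Ring A] [Algebra K A] [Module.Finite K A]
    (hA : IsGendoSymmetric K A) (hns : ¬ IsSelfinjective A) :
    ((∃ k : ℕ, 1 ≤ k ∧ rigidSize Aᵐᵒᵖ k < ⊤) → algebraDominantDim A < ⊤) ∧
    ((representationDim Aᵐᵒᵖ ≤ 3 ∨ ∃ M : ModuleCat.{u} Aᵐᵒᵖ, IsMaximalOrthogonal 1 M) →
      ∃ o w d : ℕ, rigidSize Aᵐᵒᵖ 1 = o ∧ numSimpleModules Aᵐᵒᵖ = w ∧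
        algebraDominantDim A = d ∧ 3 * ((o : ℤ) + 2 - (w : ℤ)) - 1 ≥ (d : ℤ)) := by
  obtain ⟨hdom, e, he, -, ⟨hfaith, -⟩, hdual⟩ := hA
  have hfaith' : FaithfulSMul Aᵐᵒᵖ (rightIdeal e) := hfaith
  constructor
  · rintro ⟨k, -, hk⟩
    rw [lt_top_iff_ne_top]
    intro htop
    obtain ⟨o, ho⟩ := ENat.ne_top_iff_exists.1 hk.ne
    have hlt : (((k + 2) * (o + 1) : ℕ) : ℕ∞) < algebraDominantDim A := by
      rw [htop]
      exact ENat.natCast_lt_top _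
    obtain ⟨n, hn, I, hmin, hproj⟩ := exists_of_lt_dominantDim hlt
    have := le_rigidSize_of_minimal_resolution (w := 0) he hfaith' hdual hns I hmin hproj hn.le
      (by simp)
    rw [← ho, zero_add] at this
    have : o + 1 ≤ o := by exact_mod_cast this
    omega
  · intro h
    have : Module.Finite K Aᵐᵒᵖ := Module.Finite.equiv (MulOpposite.opLinearEquiv K)
    have hRA : IsArtinianRing Aᵐᵒᵖ := isArtinian_of_tower K (inferInstance : IsArtinian K Aᵐᵒᵖ)
    have hRN : IsNoetherianRing Aᵐᵒᵖ :=
      isNoetherian_of_tower K (inferInstance : IsNoetherian K Aᵐᵒᵖ)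
    obtain ⟨m, hm⟩ := exists_rigidSize_le K Aᵐᵒᵖ h
    obtain ⟨o, ho⟩ := ENat.ne_top_iff_exists.1 (ne_top_of_le_ne_top (ENat.natCast_ne_top m) hm)
    obtain ⟨κ, _, S, -, hS⟩ := exists_finite_simple_family Aᵐᵒᵖ
    obtain ⟨w, hw⟩ := ENat.ne_top_iff_exists.1
      (ne_top_of_le_ne_top (ENat.natCast_ne_top _) (numSimpleModules_le_of_family hS))
    -- every third cosyzygy contributes to a rigid module of size at most `o`
    have key : ∀ n (I : InjectiveResolution (ModuleCat.of Aᵐᵒᵖ A)), IsMinimalResolution I →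
        (∀ i < n, Module.Projective Aᵐᵒᵖ (I.cocomplex.X i)) → w + n / 3 ≤ o := by
      intro n I hmin hproj
      have := le_rigidSize_of_minimal_resolution (k := 1) (t := n / 3) (w := w) he hfaith' hdual
        hns I hmin hproj (by omega) hw.le
      rw [← ho] at this
      exact_mod_cast this
    have hle : algebraDominantDim A ≤ ((3 * (o - w) + 2 : ℕ) : ℕ∞) := by
      refine iSup_le fun n => iSup_le ?_
      rintro ⟨I, hmin, hproj⟩
      have := key n I hmin hproj
      exact_mod_cast (by omega : n ≤ 3 * (o - w) + 2)
    obtain ⟨d, hd⟩ := ENat.ne_top_iff_exists.1 (ne_top_of_le_ne_top (ENat.natCast_ne_top _) hle)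
    have hwo : w ≤ o := by
      obtain ⟨n, -, I, hmin, hproj⟩ := exists_of_lt_dominantDim (m := 1)
        (M := ModuleCat.of Aᵐᵒᵖ A) (lt_of_lt_of_le (by norm_num) hdom)
      have := key n I hmin hproj
      omega
    rw [← hd] at hle
    have hle' : d ≤ 3 * (o - w) + 2 := by exact_mod_cast hle
    exact ⟨o, w, d, ho.symm, hw.symm, hd.symm, by omega⟩
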